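/- Let $m\ge 2$, let $0=b_0<b_1<\dots<b_m=1$, and put $l_i:=b_{i+1}-b_i$ for $0\le i\le m-1$. Let $\mathcal I_n=\{0,\dots,m-1\}^n$ be the set of words of length $n$ and $\mathcal I^*=\bigcup_{n\ge0}\mathcal I_n$. On a probability space $(\Theta,\mathscr F,\mathbb P)$ let $(y_{\omega1},\dots,y_{\omega(m-1)})$, $\omega\in\mathcal I^*$, be independent, identically distributed random vectors with values in $[0,1]^{m-1}$ (the coordinates of one vector may be dependent), and set $y_{\omega0}:=0$, $y_{\omega m}:=1$. For the empty word write $y_i$ in place of $y_{\varnothing i}$, and $a_i:=|y_{i+1}-y_i|$ for $0\le i\le m-1$. Assume that $\mathbb P(y_i\in\{0,1\})=0$ and $\mathbb P(y_{i+1}-y_i=b_{i+1}-b_i)<1$ for $i=1,\dots,m-1$. For $\omega\in\mathcal I^*$ and $0\le i\le m-1$ let $T_{\omega i}:[0,1]^2\to[0,1]^2$ be given by $$T_{\omega i}(x,t)=\big(l_i x+b_i,\ (y_{\omega(i+1)}-y_{\omega i})\,t+y_{\omega i}\big),$$ for $\omega=\omega_1\dots\omega_n$ let $R_\omega:=T_{\omega_1}\circ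 T_{\omega_1\omega_2}\circ\dots\circ T_{\omega_1\dots\omega_n}([0,1]^2)$, and let $\Gamma:=\bigcap_{n}\bigcup_{\omega\in\mathcal I_n}R_\omega$. Then almost surely $\Gamma$ is the graph of a continuous function $F:[0,1]\to[0,1]$. Let $$\varphi:=\sum_{i=0}^{m-1}l_i\,(\mathbb E\log a_i-\log l_i)\in[-\infty,\infty),$$ where $\log 0=-\infty$ and $\mathbb E\log a_i=-\infty$ is allowed. 1. If $\varphi<0$, then almost surely $F'(x)=0$ for Lebesgue-almost every $x\in[0,1]$. 2. If $\varphi\ge0$, then almost surely $F$ is non-differentiable at Lebesgue-almost every $x\in[0,1]$. -/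

import Mathlib

open MeasureTheory ProbabilityTheory Set

namespace RandomSelfAffine

noncomputable section

/-- The affine map sending the unit square onto the rectangle over `[b i, b (i+1)]` whose signed
vertical extent goes from `v i` to `v (i+1)`. -/
def cellMap {m : ℕ} (b v : Fin (m + 1) → ℝ) (i : Fin m) (p : ℝ × ℝ) : ℝ × ℝ :=
  ((b i.succ - b i.castSucc) * p.1 + b i.castSucc,
    (v i.succ - v i.castSucc) * p.2 + v i.castSucc)

/-- The composition `T_{ω₁} ∘ T_{ω₁ω₂} ∘ ⋯ ∘ T_{ω₁…ωₙ}` for a word `ω = ω₁…ωₙ`, where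
`T_{τ i} = cellMap b (u τ) i` and `u τ = (y_{τ0}, y_{τ1}, …, y_{τm})` are the heights chosen at the
word `τ`. The family `fun τ => u (i :: τ)` consists of the heights below the first-level cell `i`. -/
def wordMap {m : ℕ} (b : Fin (m + 1) → ℝ) :
    (List (Fin m) → Fin (m + 1) → ℝ) → List (Fin m) → ℝ × ℝ → ℝ × ℝ
  | _, [] => id
  | u, i :: ω => cellMap b (u []) i ∘ wordMap b (fun τ => u (i :: τ)) ω

/-- The rectangle `R_ω`. -/
def rect {m : ℕ} (b : Fin (m + 1) → ℝ) (u : List (Fin m) → Fin (m + 1) → ℝ)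
    (ω : List (Fin m)) : Set (ℝ × ℝ) :=
  wordMap b u ω '' (Icc (0 : ℝ) 1 ×ˢ Icc (0 : ℝ) 1)

/-- The limit set `Γ = ⋂ₙ ⋃_{|ω| = n} R_ω`. -/
def limitSet {m : ℕ} (b : Fin (m + 1) → ℝ) (u : List (Fin m) → Fin (m + 1) → ℝ) :
    Set (ℝ × ℝ) :=
  ⋂ n : ℕ, ⋃ ω ∈ {ω : List (Fin m) | ω.length = n}, rect b u ω

/-- The function `F` with graph `Γ`: `F x` is a number `t` with `(x, t) ∈ Γ`, and `0` if there is
none. It is the function with graph `Γ` whenever `Γ` is the graph of a function. -/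
def graphFun {m : ℕ} (b : Fin (m + 1) → ℝ) (u : List (Fin m) → Fin (m + 1) → ℝ) (x : ℝ) : ℝ :=
  open Classical in
  if h : ∃ t : ℝ, (x, t) ∈ limitSet b u then h.choose else 0

/-- The expectation `E X = E X⁺ - E X⁻` of an extended real random variable, with values in
`[-∞, ∞]` (meaningful as soon as one of the two parts has a finite integral). -/
def extExpectation {Θ : Type*} [MeasurableSpace Θ] (P : Measure Θ) (X : Θ → EReal) : EReal :=
  ((∫⁻ θ, (X θ).toENNReal ∂P : ENNReal) : EReal) - ((∫⁻ θ, (-X θ).toENNReal ∂P : ENNReal) : EReal)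

/-- `φ = ∑ᵢ lᵢ (E log aᵢ - log lᵢ)` with `lᵢ = b (i+1) - b i` and `aᵢ = |v (i+1) - v i|`, where `v`
is the random vector of heights of the first level. Here `log 0 = -∞`, and `E log aᵢ = -∞` is
allowed, so that `φ` takes values in `[-∞, ∞)` when the heights are in `[0, 1]`. -/
def phi {Θ : Type*} [MeasurableSpace Θ] (P : Measure Θ) {m : ℕ} (b : Fin (m + 1) → ℝ)
    (v : Θ → Fin (m + 1) → ℝ) : EReal :=
  ∑ i : Fin m, ((b i.succ - b i.castSucc : ℝ) : EReal) *
    (extExpectation P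
        (fun θ => ENNReal.log (ENNReal.ofReal |v θ i.succ - v θ i.castSucc|)) -
      ((Real.log (b i.succ - b i.castSucc) : ℝ) : EReal))

end

end RandomSelfAffine

/-! The increment of `F` over the base of `R_ω` is exactly `amp u ω`, so everything is read off the
slopes `|amp u ω| / len b ω`. For a point chosen by Lebesgue measure, the logarithm of the slope
along its cells is a random walk with drift `φ`.

Continuity: `E ∑ |amp|^s` over words of length `n` is `(∑ E aᵢ^s)^n`. Since `aᵢ < 1` almost surely,
the base is less than `1` for large `s`, so heights shrink uniformly (`ae_shrinks`) and the compact
set `Γ` is a graph.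

Case `φ < 0`: the function `s ↦ ∑ lᵢ E (aᵢ/lᵢ)^s` formally has value `1` and derivative `φ` at `0`,
so it is less than `1` for some `s > 0` (`exists_moment_lt_one`). By Borel–Cantelli in `x`, almost
every `x` eventually lies only in bases of exponentially small slope, and not exponentially close,
relative to the length, to their ends (`ae_flat`); this forces `F' x = 0`.

Case `φ ≥ 0`, including the critical value `0`: words are killed once their slope exceeds `K`. With
`ρ = ∑ E aᵢ`, the expected total of `potential` over the surviving words drops by at least `(ρ - 1)`
times their expected total height (`integral_alive_children`). Here `ρ > 1`, as `t - 1 - log t ≥ 0`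
gives `ρ - 1 ≥ φ`, with equality only in the excluded diagonal case (`one_lt_sum_integral_gap`).
Thus surviving height becomes small; since the potential stays bounded, surviving length becomes
small too (`le_potential`). Hence almost every `x` lies in bases of arbitrarily large slope, which
rules out a derivative. -/

namespace RandomSelfAffine

/-! ### Deterministic geometry: rectangles, the limit set and its function. -/

section

variable {m : ℕ} {b : Fin (m + 1) → ℝ} {u : List (Fin m) → Fin (m + 1) → ℝ}

/-- The signed vertical extent of `R_ω`. Applied to the constant family `fun _ => b` it is the
length of the base of `R_ω`. -/
def amp : (List (Fin m) → Fin (m + 1) → ℝ) → List (Fin m) → ℝ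
  | _, [] => 1
  | u, i :: ω => (u [] i.succ - u [] i.castSucc) * amp (fun τ => u (i :: τ)) ω

/-- The second coordinate of the image of `(0, 0)` under `wordMap b u ω`. Applied to the constant
family `fun _ => b` it is the left endpoint of the base of `R_ω`. -/
def off : (List (Fin m) → Fin (m + 1) → ℝ) → List (Fin m) → ℝ
  | _, [] => 0
  | u, i :: ω =>
    (u [] i.succ - u [] i.castSucc) * off (fun τ => u (i :: τ)) ω + u [] i.castSucc

/-- The length of the base of `R_ω`. -/
abbrev len (b : Fin (m + 1) → ℝ) (ω : List (Fin m)) : ℝ := amp (fun _ => b) ω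

/-- The left endpoint of the base of `R_ω`. -/
abbrev left (b : Fin (m + 1) → ℝ) (ω : List (Fin m)) : ℝ := off (fun _ => b) ω

theorem wordMap_apply (b : Fin (m + 1) → ℝ) (u : List (Fin m) → Fin (m + 1) → ℝ)
    (ω : List (Fin m)) (p : ℝ × ℝ) :
    wordMap b u ω p = (len b ω * p.1 + left b ω, amp u ω * p.2 + off u ω) := by
  induction ω generalizing u with
  | nil => simp [wordMap, amp, off]
  | cons i ω ih =>
    simp only [wordMap, Function.comp_apply, ih, cellMap, amp, off]
    ext <;> simp <;> ring

theorem wordMap_append (b : Fin (m + 1) → ℝ) (u : List (Fin m) → Fin (m + 1) → ℝ)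
    (ω α : List (Fin m)) :
    wordMap b u (ω ++ α) = wordMap b u ω ∘ wordMap b (fun τ => u (ω ++ τ)) α := by
  induction ω generalizing u with
  | nil => rfl
  | cons i ω ih => simp only [List.cons_append, wordMap, ih, Function.comp_assoc]

/-- The recursion for `amp` peels off the first letter, whereas independence is exploited at the
last one: `u ω` is not involved in `amp u ω`. -/
theorem amp_concat (u : List (Fin m) → Fin (m + 1) → ℝ) (ω : List (Fin m)) (i : Fin m) :
    amp u (ω ++ [i]) = amp u ω * (u ω i.succ - u ω i.castSucc) := by
  induction ω generalizing u with
  | nil => simp [amp]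
  | cons j ω ih => simp only [List.cons_append, amp, ih]; ring

/-- The nodes of a partition of `[0, 1]`. -/
structure IsPartition (b : Fin (m + 1) → ℝ) : Prop where
  strictMono : StrictMono b
  zero : b 0 = 0
  last : b (Fin.last m) = 1

/-- Heights over the nodes, equal to `0` at the first and to `1` at the last node. -/
structure IsHeights (v : Fin (m + 1) → ℝ) : Prop where
  zero : v 0 = 0
  last : v (Fin.last m) = 1
  mem : ∀ i, v i ∈ Icc (0 : ℝ) 1

theorem IsPartition.isHeights (hb : IsPartition b) : IsHeights b :=
  ⟨hb.zero, hb.last, fun i => ⟨hb.zero ▸ hb.strictMono.monotone (Fin.zero_le i),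
    hb.last ▸ hb.strictMono.monotone (Fin.le_last i)⟩⟩

theorem IsPartition.sub_pos (hb : IsPartition b) (i : Fin m) : 0 < b i.succ - b i.castSucc :=
  _root_.sub_pos.2 (hb.strictMono i.castSucc_lt_succ)

theorem IsHeights.abs_sub_le {v : Fin (m + 1) → ℝ} (hv : IsHeights v) (i j : Fin (m + 1)) :
    |v i - v j| ≤ 1 := by
  have h1 := hv.mem i
  have h2 := hv.mem j
  rw [abs_le]
  constructor <;> linarith [h1.1, h1.2, h2.1, h2.2]

theorem sum_sub_eq_one {v : Fin (m + 1) → ℝ} (hv : IsHeights v) :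
    ∑ i : Fin m, (v i.succ - v i.castSucc) = 1 := by
  have h : ∑ i : Fin m, v i.succ + v 0 = ∑ i : Fin m, v i.castSucc + v (Fin.last m) := by
    rw [← Fin.sum_univ_castSucc, Fin.sum_univ_succ, add_comm]
  rw [Finset.sum_sub_distrib]
  rw [hv.zero, hv.last] at h
  linarith

theorem len_pos (hb : IsPartition b) (ω : List (Fin m)) : 0 < len b ω := by
  induction ω with
  | nil => simp [amp]
  | cons i ω ih => exact mul_pos (hb.sub_pos i) ih

theorem abs_amp_le_one (hu : ∀ τ, IsHeights (u τ)) (ω : List (Fin m)) : |amp u ω| ≤ 1 := by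
  induction ω generalizing u with
  | nil => simp [amp]
  | cons i ω ih =>
    rw [amp, abs_mul]
    exact mul_le_one₀ ((hu []).abs_sub_le _ _) (abs_nonneg _) (ih fun τ => hu (i :: τ))

/-- The closed unit square. -/
abbrev square : Set (ℝ × ℝ) := Icc (0 : ℝ) 1 ×ˢ Icc (0 : ℝ) 1

theorem affine_mem_Icc {x y t : ℝ} (hx : x ∈ Icc (0 : ℝ) 1) (hy : y ∈ Icc (0 : ℝ) 1)
    (ht : t ∈ Icc (0 : ℝ) 1) : (y - x) * t + x ∈ Icc (0 : ℝ) 1 := by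
  obtain ⟨hx0, hx1⟩ := hx
  obtain ⟨hy0, hy1⟩ := hy
  obtain ⟨ht0, ht1⟩ := ht
  constructor
  · nlinarith [mul_nonneg hy0 ht0, mul_nonneg hx0 (sub_nonneg.2 ht1)]
  · nlinarith [mul_nonneg (sub_nonneg.2 hy1) ht0, mul_nonneg (sub_nonneg.2 hx1) (sub_nonneg.2 ht1)]

theorem mapsTo_cellMap {v : Fin (m + 1) → ℝ} (hb : IsHeights b) (hv : IsHeights v) (i : Fin m) :
    MapsTo (cellMap b v i) square square := fun _ hp =>
  ⟨affine_mem_Icc (hb.mem _) (hb.mem _) hp.1, affine_mem_Icc (hv.mem _) (hv.mem _) hp.2⟩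

theorem mapsTo_wordMap (hb : IsHeights b) (hu : ∀ τ, IsHeights (u τ)) (ω : List (Fin m)) :
    MapsTo (wordMap b u ω) square square := by
  induction ω generalizing u with
  | nil => exact mapsTo_id _
  | cons i ω ih => exact (mapsTo_cellMap hb (hu []) i).comp (ih fun τ => hu (i :: τ))

theorem rect_subset_square (hb : IsHeights b) (hu : ∀ τ, IsHeights (u τ)) (ω : List (Fin m)) :
    rect b u ω ⊆ square := (mapsTo_wordMap hb hu ω).image_subset

theorem rect_append (b : Fin (m + 1) → ℝ) (u : List (Fin m) → Fin (m + 1) → ℝ)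
    (ω α : List (Fin m)) :
    rect b u (ω ++ α) = wordMap b u ω '' rect b (fun τ => u (ω ++ τ)) α := by
  rw [rect, wordMap_append, image_comp, rect]

theorem rect_append_subset (hb : IsHeights b) (hu : ∀ τ, IsHeights (u τ)) (ω α : List (Fin m)) :
    rect b u (ω ++ α) ⊆ rect b u ω := by
  rw [rect_append]
  exact image_mono (rect_subset_square hb (fun τ => hu _) α)

theorem isCompact_rect (b : Fin (m + 1) → ℝ) (u : List (Fin m) → Fin (m + 1) → ℝ)
    (ω : List (Fin m)) : IsCompact (rect b u ω) := by
  refine (isCompact_Icc.prod isCompact_Icc).image ?_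
  have : wordMap b u ω = fun p => (len b ω * p.1 + left b ω, amp u ω * p.2 + off u ω) :=
    funext (wordMap_apply b u ω)
  rw [this]
  fun_prop

/-- The base of `R_ω`. -/
def base (b : Fin (m + 1) → ℝ) (ω : List (Fin m)) : Set ℝ := Icc (left b ω) (left b ω + len b ω)

theorem mem_base_iff (hb : IsPartition b) {ω : List (Fin m)} {x : ℝ} :
    x ∈ base b ω ↔ ∃ s ∈ Icc (0 : ℝ) 1, len b ω * s + left b ω = x := by
  have hl := len_pos hb ω
  constructor
  · rintro ⟨h1, h2⟩
    refine ⟨(x - left b ω) / len b ω, ⟨div_nonneg (by linarith) hl.le, ?_⟩, ?_⟩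
    · rw [div_le_one hl]; linarith
    · field_simp; ring
  · rintro ⟨s, ⟨h1, h2⟩, rfl⟩
    constructor <;> nlinarith

theorem fst_mem_base (hb : IsPartition b) {ω : List (Fin m)} {p : ℝ × ℝ}
    (hp : p ∈ rect b u ω) : p.1 ∈ base b ω := by
  obtain ⟨q, hq, rfl⟩ := hp
  rw [wordMap_apply, mem_base_iff hb]
  exact ⟨q.1, hq.1, rfl⟩

theorem base_subset_Icc (hb : IsPartition b) (ω : List (Fin m)) : base b ω ⊆ Icc 0 1 := by
  intro x hx
  obtain ⟨s, hs, rfl⟩ := (mem_base_iff hb).1 hx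
  have := mapsTo_wordMap (u := fun _ => b) hb.isHeights (fun _ => hb.isHeights) ω
    (⟨hs, hs⟩ : (s, s) ∈ square)
  rw [wordMap_apply] at this
  exact this.1

theorem exists_cell (hb : IsPartition b) {x : ℝ} (hx : x ∈ Icc (0 : ℝ) 1) (hm : 0 < m) :
    ∃ i : Fin m, x ∈ Icc (b i.castSucc) (b i.succ) := by
  by_contra! h
  have key : ∀ k : Fin (m + 1), b k ≤ x := by
    intro k
    induction k using Fin.induction with
    | zero => rw [hb.zero]; exact hx.1
    | succ i ih =>
      by_contra! h'
      exact h i ⟨ih, h'.le⟩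
  obtain ⟨n, rfl⟩ := Nat.exists_eq_succ_of_ne_zero hm.ne'
  refine h (Fin.last n) ⟨key _, ?_⟩
  rw [Fin.succ_last, hb.last]
  exact hx.2

theorem exists_mem_base (hb : IsPartition b) (hm : 0 < m) (n : ℕ) {x : ℝ}
    (hx : x ∈ Icc (0 : ℝ) 1) : ∃ ω : List (Fin m), ω.length = n ∧ x ∈ base b ω := by
  induction n generalizing x with
  | zero => exact ⟨[], rfl, by simpa [base, amp, off] using hx⟩
  | succ n ih =>
    obtain ⟨i, hi⟩ := exists_cell hb hx hm
    have hl := hb.sub_pos i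
    have hx' : (x - b i.castSucc) / (b i.succ - b i.castSucc) ∈ Icc (0 : ℝ) 1 :=
      ⟨div_nonneg (by linarith [hi.1]) hl.le, by rw [div_le_one hl]; linarith [hi.2]⟩
    obtain ⟨ω, hω, h⟩ := ih hx'
    refine ⟨i :: ω, by simp [hω], ?_⟩
    obtain ⟨s, hs, h⟩ := (mem_base_iff hb).1 h
    rw [mem_base_iff hb]
    refine ⟨s, hs, ?_⟩
    rw [eq_div_iff hl.ne'] at h
    simp only [amp, off] at h ⊢
    linarith

theorem base_append_subset (hb : IsPartition b) (ω α : List (Fin m)) :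
    base b (ω ++ α) ⊆ base b ω := by
  intro x hx
  obtain ⟨s, hs, h⟩ := (mem_base_iff hb).1 hx
  have h1 : (x, x) ∈ rect b (fun _ => b) (ω ++ α) :=
    ⟨(s, s), ⟨hs, hs⟩, by rw [wordMap_apply]; exact Prod.ext h h⟩
  exact fst_mem_base hb (rect_append_subset hb.isHeights (fun _ => hb.isHeights) ω α h1)

/-- The level sets of the construction of the limit set. -/
def levelSet (b : Fin (m + 1) → ℝ) (u : List (Fin m) → Fin (m + 1) → ℝ) (n : ℕ) : Set (ℝ × ℝ) :=
  ⋃ ω ∈ {ω : List (Fin m) | ω.length = n}, rect b u ω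

theorem mem_levelSet {n : ℕ} {p : ℝ × ℝ} :
    p ∈ levelSet b u n ↔ ∃ ω : List (Fin m), ω.length = n ∧ p ∈ rect b u ω := by
  simp [levelSet]

theorem mem_limitSet {p : ℝ × ℝ} :
    p ∈ limitSet b u ↔ ∀ n, ∃ ω : List (Fin m), ω.length = n ∧ p ∈ rect b u ω := by
  simp [limitSet]

theorem isCompact_levelSet (b : Fin (m + 1) → ℝ) (u : List (Fin m) → Fin (m + 1) → ℝ) (n : ℕ) :
    IsCompact (levelSet b u n) :=
  (List.finite_length_eq (Fin m) n).isCompact_biUnion fun ω _ => isCompact_rect b u ω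

theorem levelSet_anti (hb : IsHeights b) (hu : ∀ τ, IsHeights (u τ)) :
    Antitone (levelSet b u) := by
  intro k n hkn p hp
  obtain ⟨ω, hω, h⟩ := mem_levelSet.1 hp
  refine mem_levelSet.2 ⟨ω.take k, by simp [hω, hkn], ?_⟩
  rw [← List.take_append_drop k ω] at h
  exact rect_append_subset hb hu _ _ h

theorem isCompact_limitSet (b : Fin (m + 1) → ℝ) (u : List (Fin m) → Fin (m + 1) → ℝ) :
    IsCompact (limitSet b u) :=
  (isCompact_levelSet b u 0).of_isClosed_subset
    (isClosed_iInter fun n => (isCompact_levelSet b u n).isClosed) (iInter_subset _ 0)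

theorem limitSet_subset_square (hb : IsHeights b) (hu : ∀ τ, IsHeights (u τ)) :
    limitSet b u ⊆ square := by
  intro p hp
  obtain ⟨ω, -, h⟩ := mem_limitSet.1 hp 0
  exact rect_subset_square hb hu ω h

/-- Cantor's intersection theorem for the vertical slices of the decreasing compact level sets. -/
theorem exists_mem_limitSet (hb : IsPartition b) (hu : ∀ τ, IsHeights (u τ)) (hm : 0 < m) {x : ℝ}
    (hx : x ∈ Icc (0 : ℝ) 1) : ∃ t, (x, t) ∈ limitSet b u := by
  have hcl : IsClosed {p : ℝ × ℝ | p.1 = x} := isClosed_eq continuous_fst continuous_const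
  obtain ⟨p, hp⟩ := IsCompact.nonempty_iInter_of_sequence_nonempty_isCompact_isClosed
    (fun n => levelSet b u n ∩ {p : ℝ × ℝ | p.1 = x})
    (fun n => inter_subset_inter_left _ (levelSet_anti hb.isHeights hu n.le_succ))
    (fun n => by
      obtain ⟨ω, hω, h⟩ := exists_mem_base hb hm n hx
      obtain ⟨s, hs, h⟩ := (mem_base_iff hb).1 h
      exact ⟨wordMap b u ω (s, s), mem_levelSet.2 ⟨ω, hω, mem_image_of_mem _ ⟨hs, hs⟩⟩, by
        rw [wordMap_apply]; exact h⟩)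
    ((isCompact_levelSet b u 0).inter_right hcl)
    (fun n => (isCompact_levelSet b u n).isClosed.inter hcl)
  rw [mem_iInter] at hp
  have h1 : p.1 = x := (hp 0).2
  exact ⟨p.2, h1 ▸ mem_iInter.2 fun n => (hp n).1⟩

theorem wordMap_mem_limitSet (hb : IsHeights b) (hu : ∀ τ, IsHeights (u τ)) (ω : List (Fin m))
    {p : ℝ × ℝ} (hp : p ∈ limitSet b (fun τ => u (ω ++ τ))) :
    wordMap b u ω p ∈ limitSet b u := by
  refine mem_iInter.2 fun n => ?_
  -- Level sets decrease, so membership at the deeper level `ω.length + n` suffices.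
  refine levelSet_anti hb hu (Nat.le_add_left n ω.length) ?_
  obtain ⟨α, hα, h⟩ := mem_limitSet.1 hp n
  refine mem_levelSet.2 ⟨ω ++ α, by simp [hα], ?_⟩
  rw [rect_append]
  exact mem_image_of_mem _ h

/-- A base contains `0` only if all letters are the first cell, whose maps fix the origin. -/
theorem zero_mem_rect (hb : IsPartition b) (hu : ∀ τ, IsHeights (u τ)) {ω : List (Fin m)}
    (h : (0 : ℝ) ∈ base b ω) : ((0, 0) : ℝ × ℝ) ∈ rect b u ω := by
  induction ω generalizing u with
  | nil => simp [rect, wordMap]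
  | cons i ω ih =>
    obtain ⟨s, hs, h⟩ := (mem_base_iff hb).1 h
    have hl := hb.sub_pos i
    have h0 : len b ω * s + left b ω ∈ base b ω := (mem_base_iff hb).2 ⟨s, hs, rfl⟩
    have h1 := (base_subset_Icc hb ω h0).1
    have h2 := (hb.isHeights.mem i.castSucc).1
    simp only [amp, off] at h
    have h3 : b i.castSucc = 0 := by nlinarith
    have h4 : len b ω * s + left b ω = 0 := by
      have : (b i.succ - b i.castSucc) * (len b ω * s + left b ω) = 0 := by
        rw [h3] at h ⊢; linarith
      exact (mul_eq_zero.1 this).resolve_left hl.ne'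
    have h5 : i.castSucc = 0 := hb.strictMono.injective (h3.trans hb.zero.symm)
    obtain ⟨q, hq, e⟩ := ih (u := fun τ => u (i :: τ)) (fun τ => hu _) (h4 ▸ h0)
    refine ⟨q, hq, ?_⟩
    rw [wordMap, Function.comp_apply, e]
    simp [cellMap, h5, hb.zero, (hu []).zero]

theorem one_mem_rect (hb : IsPartition b) (hu : ∀ τ, IsHeights (u τ)) {ω : List (Fin m)}
    (h : (1 : ℝ) ∈ base b ω) : ((1, 1) : ℝ × ℝ) ∈ rect b u ω := by
  induction ω generalizing u with
  | nil => simp [rect, wordMap]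
  | cons i ω ih =>
    obtain ⟨s, hs, h⟩ := (mem_base_iff hb).1 h
    have hl := hb.sub_pos i
    have h0 : len b ω * s + left b ω ∈ base b ω := (mem_base_iff hb).2 ⟨s, hs, rfl⟩
    have h1 := (base_subset_Icc hb ω h0).2
    have h2 := (hb.isHeights.mem i.succ).2
    simp only [amp, off] at h
    have h6 : (b i.succ - b i.castSucc) * (1 - (len b ω * s + left b ω)) + (1 - b i.succ) = 0 := by
      linarith
    have h7 := mul_nonneg hl.le (sub_nonneg.2 h1)
    have h3 : b i.succ = 1 := by linarith
    have h4 : len b ω * s + left b ω = 1 := by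
      have : (b i.succ - b i.castSucc) * (1 - (len b ω * s + left b ω)) = 0 := by linarith
      linarith [(mul_eq_zero.1 this).resolve_left hl.ne']
    have h5 : i.succ = Fin.last m := hb.strictMono.injective (h3.trans hb.last.symm)
    obtain ⟨q, hq, e⟩ := ih (u := fun τ => u (i :: τ)) (fun τ => hu _) (h4 ▸ h0)
    refine ⟨q, hq, ?_⟩
    rw [wordMap, Function.comp_apply, e]
    simp [cellMap, h5, hb.last, (hu []).last]

/-- Bases in different first-level cells can meet only at a common node of adjacent cells, where
both rectangles have a corner at the height of that node. -/
theorem exists_mem_rect_of_lt (hb : IsPartition b) (hu : ∀ τ, IsHeights (u τ))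
    {ω ω' : List (Fin m)} {i j : Fin m} (hij : i < j) {x : ℝ} (h : x ∈ base b (i :: ω))
    (h' : x ∈ base b (j :: ω')) : ∃ t, (x, t) ∈ rect b u (i :: ω) ∧ (x, t) ∈ rect b u (j :: ω') := by
  obtain ⟨s, hs, h⟩ := (mem_base_iff hb).1 h
  obtain ⟨s', hs', h'⟩ := (mem_base_iff hb).1 h'
  have hl := hb.sub_pos i
  have hl' := hb.sub_pos j
  have h0 : len b ω * s + left b ω ∈ base b ω := (mem_base_iff hb).2 ⟨s, hs, rfl⟩
  have h0' : len b ω' * s' + left b ω' ∈ base b ω' := (mem_base_iff hb).2 ⟨s', hs', rfl⟩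
  have h1 := (base_subset_Icc hb ω h0).2
  have h1' := (base_subset_Icc hb ω' h0').1
  have hle : i.succ ≤ j.castSucc := by
    rw [Fin.le_def]; simpa using hij
  have h2 := hb.strictMono.monotone hle
  simp only [amp, off] at h h'
  have e1 := mul_nonneg hl.le (sub_nonneg.2 h1)
  have e2 := mul_nonneg hl'.le h1'
  have h3 : (b i.succ - b i.castSucc) * (1 - (len b ω * s + left b ω)) = 0 := by linarith
  have h3' : (b j.succ - b j.castSucc) * (len b ω' * s' + left b ω') = 0 := by linarith
  have h4 : 1 = len b ω * s + left b ω := by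
    linarith [(mul_eq_zero.1 h3).resolve_left hl.ne']
  have h4' := (mul_eq_zero.1 h3').resolve_left hl'.ne'
  have h5 : i.succ = j.castSucc := hb.strictMono.injective (by linarith)
  obtain ⟨q, hq, e⟩ := one_mem_rect (u := fun τ => u (i :: τ)) hb (fun τ => hu _) (h4 ▸ h0)
  obtain ⟨q', hq', e'⟩ := zero_mem_rect (u := fun τ => u (j :: τ)) hb (fun τ => hu _) (h4' ▸ h0')
  refine ⟨u [] i.succ, ⟨q, hq, ?_⟩, ⟨q', hq', ?_⟩⟩
  · rw [wordMap, Function.comp_apply, e]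
    ext <;> simp [cellMap]
    linarith
  · rw [wordMap, Function.comp_apply, e']
    ext <;> simp [cellMap, h5]
    linarith

theorem exists_mem_rect_inter (hb : IsPartition b) (hu : ∀ τ, IsHeights (u τ))
    {ω ω' : List (Fin m)} (hlen : ω.length = ω'.length) {x : ℝ} (h : x ∈ base b ω)
    (h' : x ∈ base b ω') : ∃ t, (x, t) ∈ rect b u ω ∧ (x, t) ∈ rect b u ω' := by
  induction ω generalizing u ω' x with
  | nil =>
    obtain rfl := List.eq_nil_of_length_eq_zero hlen.symm
    refine ⟨0, ?_⟩
    simpa [rect, wordMap, base, amp, off] using h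
  | cons i ω ih =>
    obtain _ | ⟨j, ω'⟩ := ω'
    · simp at hlen
    obtain hij | rfl | hij := lt_trichotomy i j
    · exact exists_mem_rect_of_lt hb hu hij h h'
    · obtain ⟨s, hs, h⟩ := (mem_base_iff hb).1 h
      obtain ⟨s', hs', h'⟩ := (mem_base_iff hb).1 h'
      have hl := hb.sub_pos i
      simp only [amp, off] at h h'
      have e : len b ω * s + left b ω = len b ω' * s' + left b ω' :=
        mul_left_cancel₀ hl.ne' (by linarith)
      obtain ⟨t, ⟨q, hq, e1⟩, q', hq', e2⟩ := ih (u := fun τ => u (i :: τ)) (fun τ => hu _)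
        (by simpa using hlen)
        ((mem_base_iff hb).2 ⟨s, hs, rfl⟩) ((mem_base_iff hb).2 ⟨s', hs', e.symm⟩)
      have e3 : x = (b i.succ - b i.castSucc) * (len b ω * s + left b ω) + b i.castSucc := by
        linarith
      refine ⟨(u [] i.succ - u [] i.castSucc) * t + u [] i.castSucc, ⟨q, hq, ?_⟩, ⟨q', hq', ?_⟩⟩
      · rw [wordMap, Function.comp_apply, e1, cellMap, e3]
      · rw [wordMap, Function.comp_apply, e2, cellMap, e3]
    · obtain ⟨t, h1, h2⟩ := exists_mem_rect_of_lt hb hu hij h' h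
      exact ⟨t, h2, h1⟩

theorem abs_snd_sub_le {ω : List (Fin m)} {p q : ℝ × ℝ} (hp : p ∈ rect b u ω)
    (hq : q ∈ rect b u ω) : |p.2 - q.2| ≤ |amp u ω| := by
  obtain ⟨p, hp, rfl⟩ := hp
  obtain ⟨q, hq, rfl⟩ := hq
  simp only [wordMap_apply]
  rw [show amp u ω * p.2 + off u ω - (amp u ω * q.2 + off u ω) = amp u ω * (p.2 - q.2) by ring,
    abs_mul]
  refine mul_le_of_le_one_right (abs_nonneg _) ?_
  rw [abs_le]
  constructor <;> linarith [hp.2.1, hp.2.2, hq.2.1, hq.2.2]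

/-- The vertical extents of the rectangles tend to zero uniformly. -/
def Shrinks (u : List (Fin m) → Fin (m + 1) → ℝ) : Prop :=
  ∀ ε > 0, ∃ n, ∀ ω : List (Fin m), ω.length = n → |amp u ω| ≤ ε

/-- Rectangles of equal level over the same `x` share a point above `x`, so two points of `Γ` over
`x` differ by at most two rectangle heights. -/
theorem limitSet_unique (hb : IsPartition b) (hu : ∀ τ, IsHeights (u τ)) (hs : Shrinks u)
    {x t t' : ℝ} (h : (x, t) ∈ limitSet b u) (h' : (x, t') ∈ limitSet b u) : t = t' := by
  refine eq_of_forall_dist_le fun ε hε => ?_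
  obtain ⟨n, hn⟩ := hs (ε / 2) (half_pos hε)
  obtain ⟨ω, hω, h⟩ := mem_limitSet.1 h n
  obtain ⟨ω', hω', h'⟩ := mem_limitSet.1 h' n
  obtain ⟨r, h1, h2⟩ := exists_mem_rect_inter hb hu (hω.trans hω'.symm) (x := x)
    (fst_mem_base hb h) (fst_mem_base hb h')
  have e1 := (abs_snd_sub_le h h1).trans (hn ω hω)
  have e2 := (abs_snd_sub_le h2 h').trans (hn ω' hω')
  rw [Real.dist_eq]
  calc |t - t'| ≤ |t - r| + |r - t'| := abs_sub_le _ _ _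
    _ ≤ ε := by linarith

theorem graphFun_mem (hb : IsPartition b) (hu : ∀ τ, IsHeights (u τ)) (hm : 0 < m) {x : ℝ}
    (hx : x ∈ Icc (0 : ℝ) 1) : (x, graphFun b u x) ∈ limitSet b u := by
  have h := exists_mem_limitSet hb hu hm hx
  rw [graphFun, dif_pos h]
  exact h.choose_spec

theorem limitSet_eq_graphOn (hb : IsPartition b) (hu : ∀ τ, IsHeights (u τ)) (hm : 0 < m)
    (hs : Shrinks u) : limitSet b u = (Icc (0 : ℝ) 1).graphOn (graphFun b u) := by
  ext ⟨x, t⟩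
  rw [mem_graphOn]
  constructor
  · intro h
    have hx := (limitSet_subset_square hb.isHeights hu h).1
    exact ⟨hx, limitSet_unique hb hu hs (graphFun_mem hb hu hm hx) h⟩
  · rintro ⟨hx, h⟩
    have := graphFun_mem hb hu hm hx
    rwa [show graphFun b u x = t from h] at this

theorem graphFun_eq (hb : IsPartition b) (hu : ∀ τ, IsHeights (u τ)) (hm : 0 < m)
    (hs : Shrinks u) {x t : ℝ} (h : (x, t) ∈ limitSet b u) : graphFun b u x = t := by
  rw [limitSet_eq_graphOn hb hu hm hs, mem_graphOn] at h
  exact h.2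

theorem mapsTo_graphFun (hb : IsPartition b) (hu : ∀ τ, IsHeights (u τ)) (hm : 0 < m) :
    MapsTo (graphFun b u) (Icc 0 1) (Icc 0 1) := fun _ hx =>
  (limitSet_subset_square hb.isHeights hu (graphFun_mem hb hu hm hx)).2

/-- Closed graph argument: the preimage of a closed set is the projection of a compact piece of `Γ`.
-/
theorem continuousOn_graphFun (hb : IsPartition b) (hu : ∀ τ, IsHeights (u τ)) (hm : 0 < m)
    (hs : Shrinks u) : ContinuousOn (graphFun b u) (Icc 0 1) := by
  rw [continuousOn_iff_isClosed]
  intro t ht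
  refine ⟨Prod.fst '' (limitSet b u ∩ Prod.snd ⁻¹' t),
    (((isCompact_limitSet b u).inter_right (ht.preimage continuous_snd)).image
      continuous_fst).isClosed, ?_⟩
  rw [limitSet_eq_graphOn hb hu hm hs]
  ext x
  simp only [mem_inter_iff, mem_preimage, mem_image, mem_graphOn, Prod.exists, exists_and_right,
    exists_eq_right]
  constructor
  · rintro ⟨h, hx⟩; exact ⟨⟨_, ⟨hx, rfl⟩, h⟩, hx⟩
  · rintro ⟨⟨_, ⟨hx, rfl⟩, h⟩, -⟩; exact ⟨h, hx⟩

/-- Membership in `Γ` gives only some rectangle of each level. The copy of the limit set inside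
`R_ω` has a point over `x`, and by uniqueness it is the point of the graph. -/
theorem graphFun_mem_rect (hb : IsPartition b) (hu : ∀ τ, IsHeights (u τ)) (hm : 0 < m)
    (hs : Shrinks u) {ω : List (Fin m)} {x : ℝ} (hx : x ∈ base b ω) :
    (x, graphFun b u x) ∈ rect b u ω := by
  obtain ⟨s, hs', rfl⟩ := (mem_base_iff hb).1 hx
  have h1 := graphFun_mem (u := fun τ => u (ω ++ τ)) hb (fun τ => hu _) hm hs'
  have h2 := wordMap_mem_limitSet hb.isHeights hu ω h1
  have h3 := mem_image_of_mem (wordMap b u ω)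
    (limitSet_subset_square hb.isHeights (fun τ => hu _) h1)
  rw [wordMap_apply] at h2 h3
  rw [graphFun_eq hb hu hm hs h2]
  exact h3

theorem abs_graphFun_sub_le (hb : IsPartition b) (hu : ∀ τ, IsHeights (u τ)) (hm : 0 < m)
    (hs : Shrinks u) {ω : List (Fin m)} {x y : ℝ} (hx : x ∈ base b ω) (hy : y ∈ base b ω) :
    |graphFun b u x - graphFun b u y| ≤ |amp u ω| :=
  abs_snd_sub_le (graphFun_mem_rect hb hu hm hs hx) (graphFun_mem_rect hb hu hm hs hy)

theorem zero_mem_limitSet (hb : IsPartition b) (hu : ∀ τ, IsHeights (u τ)) (hm : 0 < m) :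
    ((0, 0) : ℝ × ℝ) ∈ limitSet b u := mem_limitSet.2 fun n => by
  obtain ⟨ω, hω, h⟩ := exists_mem_base hb hm n (x := 0) (by simp)
  exact ⟨ω, hω, zero_mem_rect hb hu h⟩

theorem one_mem_limitSet (hb : IsPartition b) (hu : ∀ τ, IsHeights (u τ)) (hm : 0 < m) :
    ((1, 1) : ℝ × ℝ) ∈ limitSet b u := mem_limitSet.2 fun n => by
  obtain ⟨ω, hω, h⟩ := exists_mem_base hb hm n (x := 1) (by simp)
  exact ⟨ω, hω, one_mem_rect hb hu h⟩

theorem graphFun_endpoints (hb : IsPartition b) (hu : ∀ τ, IsHeights (u τ)) (hm : 0 < m)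
    (hs : Shrinks u) (ω : List (Fin m)) :
    graphFun b u (left b ω + len b ω) - graphFun b u (left b ω) = amp u ω := by
  have h0 := wordMap_mem_limitSet hb.isHeights hu ω
    (zero_mem_limitSet (u := fun τ => u (ω ++ τ)) hb (fun τ => hu _) hm)
  have h1 := wordMap_mem_limitSet hb.isHeights hu ω
    (one_mem_limitSet (u := fun τ => u (ω ++ τ)) hb (fun τ => hu _) hm)
  rw [wordMap_apply] at h0 h1
  simp only [mul_zero, zero_add, mul_one] at h0 h1
  rw [add_comm (left b ω), graphFun_eq hb hu hm hs h0, graphFun_eq hb hu hm hs h1]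
  ring

end

/-! ### Slopes and differentiability; almost every point for a fixed family of heights. -/

section

variable {m : ℕ} {b : Fin (m + 1) → ℝ} {u : List (Fin m) → Fin (m + 1) → ℝ}

theorem len_concat (b : Fin (m + 1) → ℝ) (ω : List (Fin m)) (i : Fin m) :
    len b (ω ++ [i]) = len b ω * (b i.succ - b i.castSucc) := amp_concat _ ω i

theorem len_le_one (hb : IsPartition b) (ω : List (Fin m)) : len b ω ≤ 1 :=
  (le_abs_self _).trans (abs_amp_le_one (fun _ => hb.isHeights) ω)

theorem IsPartition.exists_le_sub (hb : IsPartition b) :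
    ∃ c : ℝ, 0 < c ∧ c ≤ 1 ∧ ∀ i : Fin m, c ≤ b i.succ - b i.castSucc := by
  have h : ∀ i ∈ (Finset.univ : Finset (Fin m)), 0 < b i.succ - b i.castSucc :=
    fun i _ => hb.sub_pos i
  obtain hm | hm := (Finset.univ : Finset (Fin m)).eq_empty_or_nonempty
  · exact ⟨1, one_pos, le_rfl, fun i => absurd (Finset.mem_univ i) (hm ▸ Finset.notMem_empty i)⟩
  · obtain ⟨i, -, hi⟩ := Finset.exists_min_image Finset.univ
      (fun i : Fin m => b i.succ - b i.castSucc) hm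
    exact ⟨_, hb.sub_pos i, (le_abs_self _).trans (hb.isHeights.abs_sub_le _ _),
      fun j => hi j (Finset.mem_univ j)⟩

/-- A derivative `D` at `x` bounds difference quotients from `x` by `|D| + 1` nearby. Adding the
bounds at the two ends of a small base around `x` bounds its slope by the same constant. -/
theorem not_differentiableWithinAt_of_steep (hb : IsPartition b) (hu : ∀ τ, IsHeights (u τ))
    (hm : 0 < m) (hs : Shrinks u) {x : ℝ}
    (hx : ∀ K : ℕ, ∃ τ : List (Fin m), x ∈ base b τ ∧ K * len b τ < |amp u τ|) :
    ¬ DifferentiableWithinAt ℝ (graphFun b u) (Icc 0 1) x := by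
  intro hd
  have h := (hasDerivWithinAt_iff_isLittleO.1 hd.hasDerivWithinAt).def one_pos
  set D := derivWithin (graphFun b u) (Icc 0 1) x
  obtain ⟨ε, hε, h⟩ := Metric.mem_nhdsWithin_iff.1 h
  have hlip : ∀ y ∈ Icc (0 : ℝ) 1, |y - x| < ε →
      |graphFun b u y - graphFun b u x| ≤ (|D| + 1) * |y - x| := by
    intro y hy hyx
    have h1 := h ⟨by rwa [Metric.mem_ball, Real.dist_eq], hy⟩
    simp only [mem_ofPred_eq, Real.norm_eq_abs, one_mul, smul_eq_mul] at h1
    calc |graphFun b u y - graphFun b u x|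
        = |(graphFun b u y - graphFun b u x - (y - x) * D) + (y - x) * D| := by ring_nf
      _ ≤ |y - x| + |(y - x) * D| := (abs_add_le _ _).trans (by gcongr)
      _ = (|D| + 1) * |y - x| := by rw [abs_mul]; ring
  -- The first bound contradicts the slope estimate; the second makes the base shorter than `ε`,
  -- because `K * len < |amp| ≤ 1`.
  obtain ⟨K, hK⟩ := exists_nat_gt (max (|D| + 1) (1 / ε))
  obtain ⟨hK1, hK2⟩ := max_lt_iff.1 hK
  obtain ⟨τ, hτ, hlt⟩ := hx K
  have hl := len_pos hb τ
  have hsmall : len b τ < ε := by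
    have h1 := hlt.trans_le (abs_amp_le_one hu τ)
    rw [div_lt_iff₀ hε] at hK2
    have hK0 : (0 : ℝ) < K := by linarith [abs_nonneg D]
    nlinarith
  have hL : left b τ ∈ base b τ := ⟨le_rfl, by linarith⟩
  have hR : left b τ + len b τ ∈ base b τ := ⟨by linarith, le_rfl⟩
  have hxL : |left b τ - x| = x - left b τ := by
    rw [abs_sub_comm]; exact abs_of_nonneg (by linarith [hτ.1])
  have hxR : |left b τ + len b τ - x| = left b τ + len b τ - x :=
    abs_of_nonneg (by linarith [hτ.2])
  have e1 := hlip _ (base_subset_Icc hb τ hL) (by rw [hxL]; linarith [hτ.2])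
  have e2 := hlip _ (base_subset_Icc hb τ hR) (by rw [hxR]; linarith [hτ.1])
  rw [hxL] at e1
  rw [hxR] at e2
  have e3 := abs_sub_le (graphFun b u (left b τ + len b τ)) (graphFun b u x)
    (graphFun b u (left b τ))
  rw [graphFun_endpoints hb hu hm hs, abs_sub_comm (graphFun b u x)] at e3
  nlinarith

/-- As `x` keeps a margin `δ ^ n * len` from the ends of its level-`n` base, a nearby `y` shares a
base whose margin is comparable, up to the factor `δ * c`, to `|y - x|`. The height of that base is
smaller than the margin by a further factor `δ ^ n`. -/
theorem hasDerivWithinAt_zero_of_flat (hb : IsPartition b) (hu : ∀ τ, IsHeights (u τ))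
    (hm : 0 < m) (hs : Shrinks u) {x δ : ℝ} (hx : x ∈ Icc (0 : ℝ) 1) (hδ0 : 0 < δ) (hδ1 : δ < 1)
    (h : ∃ n₀, ∀ n ≥ n₀, ∀ ω : List (Fin m), ω.length = n → x ∈ base b ω →
      |amp u ω| ≤ δ ^ (2 * n) * len b ω ∧ left b ω + δ ^ n * len b ω ≤ x ∧
        x ≤ left b ω + len b ω - δ ^ n * len b ω) :
    HasDerivWithinAt (graphFun b u) 0 (Icc 0 1) x := by
  obtain ⟨n₀, h⟩ := h
  obtain ⟨c, hc0, hc1, hc⟩ := hb.exists_le_sub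
  rw [hasDerivWithinAt_iff_isLittleO, Asymptotics.isLittleO_iff]
  intro ε hε
  -- The factor `δ * c` pays for passing from one level to the next: the margin shrinks by at most
  -- that much.
  obtain ⟨k, hk⟩ := exists_pow_lt_of_lt_one (mul_pos hε (mul_pos hδ0 hc0)) hδ1
  set n₁ := max n₀ k with hn₁
  have hlen : ∀ ω : List (Fin m), c ^ ω.length ≤ len b ω := by
    intro ω
    induction ω using List.reverseRecOn with
    | nil => simp [amp]
    | append_singleton ω i ih =>
      rw [len_concat, List.length_append, List.length_singleton, pow_succ]
      exact mul_le_mul ih (hc i) hc0.le (len_pos hb ω).le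
  refine Metric.mem_nhdsWithin_iff.2 ⟨δ ^ n₁ * c ^ n₁, by positivity, ?_⟩
  rintro y ⟨hyx, hy⟩
  rw [Metric.mem_ball, Real.dist_eq] at hyx
  simp only [mem_ofPred_eq, smul_zero, sub_zero, Real.norm_eq_abs]
  obtain rfl | hne := eq_or_ne y x
  · simp
  have hpos : 0 < |y - x| := abs_pos.2 (sub_ne_zero.2 hne)
  obtain ⟨N, hN⟩ := exists_pow_lt_of_lt_one hpos hδ1
  obtain ⟨ω, hω, hxω⟩ := exists_mem_base hb hm N hx
  have hxt : ∀ n, x ∈ base b (ω.take n) := fun n =>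
    base_append_subset hb (ω.take n) (ω.drop n) (by rwa [List.take_append_drop])
  have hn₁N : n₁ ≤ N := by
    by_contra! hlt
    have h1 : δ ^ n₁ * c ^ n₁ ≤ δ ^ N := by
      calc δ ^ n₁ * c ^ n₁ ≤ δ ^ n₁ * 1 := by gcongr; exact pow_le_one₀ hc0.le hc1
        _ ≤ δ ^ N := by rw [mul_one]; exact pow_le_pow_of_le_one hδ0.le hδ1.le hlt.le
    linarith
  -- The first such level is used: there the margin is below `|y - x|`, while one level earlier it
  -- is not, so `y` still lies in that earlier base.
  have hex : ∃ n, n₁ ≤ n ∧ δ ^ n * len b (ω.take n) < |y - x| :=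
    ⟨N, hn₁N, (mul_le_of_le_one_right (by positivity) (len_le_one hb _)).trans_lt hN⟩
  classical
  obtain ⟨hj1, hj2⟩ := Nat.find_spec hex
  have hjmin := fun k => Nat.find_min (H := hex) (m := k)
  have hjle : Nat.find hex ≤ N := Nat.find_min' hex
    ⟨hn₁N, (mul_le_of_le_one_right (by positivity) (len_le_one hb _)).trans_lt hN⟩
  -- The radius `δ ^ n₁ * c ^ n₁` was chosen so that the level found is not `n₁` itself and has a
  -- predecessor at least `n₁`.
  obtain hj | hj := hj1.eq_or_lt
  · exfalso
    rw [← hj] at hj2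
    have h1 := hlen (ω.take n₁)
    rw [List.length_take, hω, min_eq_left hn₁N] at h1
    have h2 : δ ^ n₁ * c ^ n₁ ≤ δ ^ n₁ * len b (ω.take n₁) := by gcongr
    linarith
  obtain ⟨n, hn⟩ := Nat.exists_eq_succ_of_ne_zero (Nat.ne_zero_of_lt hj)
  rw [hn] at hj hj2 hjle
  have hnle : n₁ ≤ n := Nat.lt_succ_iff.1 hj
  have hge : |y - x| ≤ δ ^ n * len b (ω.take n) := by
    have := hjmin n (hn ▸ Nat.lt_succ_self n)
    push Not at this
    exact this hnle
  have hnN : n < ω.length := hω ▸ hjle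
  obtain ⟨h1, h2, h3⟩ := h n ((le_max_left _ _).trans hnle) (ω.take n) (by simp; omega) (hxt n)
  obtain ⟨h4, h5⟩ := abs_le.1 hge
  have hyb : y ∈ base b (ω.take n) := ⟨by linarith, by linarith⟩
  refine (abs_graphFun_sub_le hb hu hm hs hyb (hxt n)).trans ?_
  have h6 : c * len b (ω.take n) ≤ len b (ω.take (n + 1)) := by
    rw [List.take_succ_eq_append_getElem hnN, len_concat, mul_comm]
    exact mul_le_mul_of_nonneg_left (hc _) (len_pos hb _).le
  have hln := len_pos hb (ω.take n)
  have h7 : δ ^ n ≤ ε * (δ * c) :=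
    (pow_le_pow_of_le_one hδ0.le hδ1.le ((le_max_right _ _).trans hnle)).trans hk.le
  calc |amp u (ω.take n)| ≤ δ ^ (2 * n) * len b (ω.take n) := h1
    _ = δ ^ n * (δ ^ n * len b (ω.take n)) := by ring
    _ ≤ (ε * (δ * c)) * (δ ^ n * len b (ω.take n)) := by gcongr
    _ = ε * (δ ^ (n + 1) * (c * len b (ω.take n))) := by ring
    _ ≤ ε * (δ ^ (n + 1) * len b (ω.take (n + 1))) := by gcongr
    _ ≤ ε * |y - x| := by gcongr

/-- The words of length `n`. -/
def words (m : ℕ) : ℕ → Finset (List (Fin m))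
  | 0 => {[]}
  | n + 1 => (words m n ×ˢ Finset.univ).image fun p => p.1 ++ [p.2]

theorem mem_words {n : ℕ} {ω : List (Fin m)} : ω ∈ words m n ↔ ω.length = n := by
  induction n generalizing ω with
  | zero => simp [words]
  | succ n ih =>
    simp only [words, Finset.mem_image, Finset.mem_product, Finset.mem_univ, and_true, Prod.exists]
    constructor
    · rintro ⟨α, i, hα, rfl⟩
      simp [ih.1 hα]
    · intro h
      obtain rfl | ⟨α, i, rfl⟩ := ω.eq_nil_or_concat
      · simp at h
      · exact ⟨α, i, ih.2 (by simpa using h), by simp⟩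

theorem sum_words_zero {M : Type*} [AddCommMonoid M] (f : List (Fin m) → M) :
    ∑ ω ∈ words m 0, f ω = f [] := by simp [words]

theorem sum_words_succ {M : Type*} [AddCommMonoid M] (n : ℕ) (f : List (Fin m) → M) :
    ∑ ω ∈ words m (n + 1), f ω = ∑ ω ∈ words m n, ∑ i, f (ω ++ [i]) := by
  rw [words, Finset.sum_image, Finset.sum_product]
  rintro ⟨α, i⟩ - ⟨β, j⟩ - h
  simpa [List.append_inj_left', Prod.ext_iff] using h

theorem sum_len (hb : IsPartition b) (n : ℕ) : ∑ ω ∈ words m n, len b ω = 1 := by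
  induction n with
  | zero => simp [sum_words_zero, amp]
  | succ n ih =>
    rw [sum_words_succ, ← ih]
    refine Finset.sum_congr rfl fun ω _ => ?_
    simp only [len_concat, ← Finset.mul_sum, sum_sub_eq_one hb.isHeights, mul_one]

theorem volume_base (b : Fin (m + 1) → ℝ) (ω : List (Fin m)) :
    volume (base b ω) = ENNReal.ofReal (len b ω) := by
  rw [base, Real.volume_Icc, add_sub_cancel_left]

/-- Borel–Cantelli for Lebesgue measure: at level `n` the steep bases have total length at most the
sum of the weights `w`, and the margins total at most `2 * δ ^ n`. -/
theorem ae_flat (hb : IsPartition b) {δ : ℝ} (hδ0 : 0 < δ) (hδ1 : δ < 1)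
    (w : List (Fin m) → ENNReal)
    (hw : ∀ ω, δ ^ (2 * ω.length) * len b ω < |amp u ω| → ENNReal.ofReal (len b ω) ≤ w ω)
    (hsum : ∑' n, ∑ ω ∈ words m n, w ω ≠ ⊤) :
    ∀ᵐ x, ∃ n₀, ∀ n ≥ n₀, ∀ ω : List (Fin m), ω.length = n → x ∈ base b ω →
      |amp u ω| ≤ δ ^ (2 * n) * len b ω ∧ left b ω + δ ^ n * len b ω ≤ x ∧
        x ≤ left b ω + len b ω - δ ^ n * len b ω := by
  classical
  let bad (n : ℕ) (ω : List (Fin m)) : Set ℝ :=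
    (if δ ^ (2 * ω.length) * len b ω < |amp u ω| then base b ω else ∅) ∪
      (Icc (left b ω) (left b ω + δ ^ n * len b ω) ∪
        Icc (left b ω + len b ω - δ ^ n * len b ω) (left b ω + len b ω))
  have hbad : ∀ n ω, volume (bad n ω) ≤ w ω + ENNReal.ofReal (2 * δ ^ n * len b ω) := by
    intro n ω
    have hl := len_pos hb ω
    refine (measure_union_le _ _).trans (add_le_add ?_ ((measure_union_le _ _).trans ?_))
    · split_ifs with h
      · rw [volume_base]; exact hw ω h
      · simp
    · rw [Real.volume_Icc, Real.volume_Icc, ← ENNReal.ofReal_add (by ring_nf; positivity)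
        (by ring_nf; positivity)]
      exact ENNReal.ofReal_le_ofReal (by ring_nf; rfl)
  have hle : ∀ n, volume (⋃ ω ∈ words m n, bad n ω) ≤
      ∑ ω ∈ words m n, w ω + ENNReal.ofReal (2 * δ ^ n) := by
    intro n
    refine (measure_biUnion_finset_le _ _).trans ((Finset.sum_le_sum fun ω _ => hbad n ω).trans ?_)
    rw [Finset.sum_add_distrib, ← ENNReal.ofReal_sum_of_nonneg
      (fun ω _ => mul_nonneg (by positivity) (len_pos hb ω).le), ← Finset.mul_sum, sum_len hb,
      mul_one]
  have htop : ∑' n, volume (⋃ ω ∈ words m n, bad n ω) ≠ ⊤ := by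
    refine ne_top_of_le_ne_top ?_ (ENNReal.tsum_le_tsum hle)
    rw [ENNReal.tsum_add]
    refine ENNReal.add_ne_top.2 ⟨hsum, ?_⟩
    exact ((summable_geometric_of_lt_one hδ0.le hδ1).mul_left 2).tsum_ofReal_ne_top
  filter_upwards [ae_eventually_notMem htop] with x hx
  obtain ⟨n₀, h⟩ := Filter.eventually_atTop.1 hx
  refine ⟨n₀, fun n hn ω hω hxω => ?_⟩
  have h1 := h n hn
  simp only [mem_iUnion, not_exists] at h1
  have h2 := h1 ω (mem_words.2 hω)
  simp only [bad, mem_union, not_or, hω] at h2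
  obtain ⟨h3, h4, h5⟩ := h2
  refine ⟨?_, ?_, ?_⟩
  · by_contra! h6
    rw [if_pos h6] at h3
    exact h3 hxω
  · by_contra! h6
    exact h4 ⟨hxω.1, h6.le⟩
  · by_contra! h6
    exact h5 ⟨h6.le, hxω.2⟩

/-- All the rectangles `R_τ` with a prefix `τ` of `ω` have slope at most `K`. -/
def Alive (b : Fin (m + 1) → ℝ) (K : ℝ) (u : List (Fin m) → Fin (m + 1) → ℝ)
    (ω : List (Fin m)) : Prop :=
  ∀ τ, τ <+: ω → |amp u τ| ≤ K * len b τ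

theorem alive_concat {K : ℝ} {ω : List (Fin m)} {i : Fin m} :
    Alive b K u (ω ++ [i]) ↔
      Alive b K u ω ∧ |amp u (ω ++ [i])| ≤ K * len b (ω ++ [i]) := by
  constructor
  · exact fun h => ⟨fun τ hτ => h τ (hτ.trans (List.prefix_append _ _)), h _ List.prefix_rfl⟩
  · rintro ⟨h1, h2⟩ τ hτ
    rw [List.prefix_concat_iff] at hτ
    obtain rfl | hτ := hτ
    · exact h2
    · exact h1 τ hτ

open Classical in
/-- The total length of the bases of the alive words of length `n`. -/
noncomputable def aliveLength (b : Fin (m + 1) → ℝ) (K : ℝ)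
    (u : List (Fin m) → Fin (m + 1) → ℝ) (n : ℕ) : ℝ :=
  ∑ ω ∈ words m n, if Alive b K u ω then len b ω else 0

/-- A point in no base of slope above `K` lies, at every level, in the base of an alive word, so
such points are covered by sets of measure `aliveLength`. -/
theorem ae_steep (hb : IsPartition b) (hm : 0 < m)
    (h : ∀ K : ℕ, ∀ ε > 0, ∃ n, aliveLength b K u n ≤ ε) :
    ∀ᵐ x ∂(volume.restrict (Icc (0 : ℝ) 1)),
      ∀ K : ℕ, ∃ τ : List (Fin m), x ∈ base b τ ∧ K * len b τ < |amp u τ| := by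
  classical
  rw [ae_restrict_iff' measurableSet_Icc]
  have key : ∀ K : ℕ, ∀ᵐ x, x ∈ Icc (0 : ℝ) 1 →
      ∃ τ : List (Fin m), x ∈ base b τ ∧ K * len b τ < |amp u τ| := by
    intro K
    rw [ae_iff]
    refine le_antisymm (ENNReal.le_of_forall_pos_le_add fun ε hε _ => ?_) bot_le
    obtain ⟨n, hn⟩ := h K ε hε
    have hsub : {x | ¬ (x ∈ Icc (0 : ℝ) 1 →
        ∃ τ : List (Fin m), x ∈ base b τ ∧ K * len b τ < |amp u τ|)} ⊆
        ⋃ ω ∈ words m n, if Alive b K u ω then base b ω else ∅ := by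
      intro x hx
      simp only [mem_ofPred_eq, Classical.not_imp, not_exists, not_and, not_lt] at hx
      obtain ⟨hx, hτ⟩ := hx
      obtain ⟨ω, hω, hxω⟩ := exists_mem_base hb hm n hx
      refine mem_biUnion (mem_words.2 hω) ?_
      rw [if_pos]
      · exact hxω
      · rintro τ ⟨α, rfl⟩
        exact hτ τ (base_append_subset hb τ α hxω)
    refine (measure_mono hsub).trans ((measure_biUnion_finset_le _ _).trans ?_)
    rw [zero_add, ← ENNReal.ofReal_coe_nnreal]
    refine le_trans (le_of_eq ?_) (ENNReal.ofReal_le_ofReal hn)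
    rw [aliveLength, ENNReal.ofReal_sum_of_nonneg]
    · refine Finset.sum_congr rfl fun ω _ => ?_
      split_ifs
      · exact volume_base b ω
      · simp
    · intro ω _
      split_ifs
      · exact (len_pos hb ω).le
      · exact le_rfl
  filter_upwards [ae_all_iff.2 key] with x hx hxI K using hx K hxI

end

/-! ### Independence along the random tree and uniform shrinking. -/

section

variable {m : ℕ} {b : Fin (m + 1) → ℝ} {Θ : Type*} {y : List (Fin m) → Θ → Fin (m + 1) → ℝ}

/-- The σ-algebra generated by the heights of the words of length less than `n`. -/
@[reducible] def past (y : List (Fin m) → Θ → Fin (m + 1) → ℝ) (n : ℕ) : MeasurableSpace Θ :=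
  ⨆ τ ∈ {τ : List (Fin m) | τ.length < n}, MeasurableSpace.comap (y τ) inferInstance

theorem past_mono {k n : ℕ} (h : k ≤ n) : past y k ≤ past y n :=
  biSup_mono fun _ hτ => lt_of_lt_of_le hτ h

theorem measurable_past {n : ℕ} {ω : List (Fin m)} (h : ω.length < n) :
    Measurable[past y n] (y ω) :=
  Measurable.of_comap_le
    (le_iSup₂ (f := fun (τ : List (Fin m)) (_ : τ ∈ {τ : List (Fin m) | τ.length < n}) =>
      MeasurableSpace.comap (y τ) inferInstance) ω h)

theorem measurable_past_amp (ω : List (Fin m)) :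
    Measurable[past y ω.length] fun θ => amp (fun τ => y τ θ) ω := by
  induction ω using List.reverseRecOn with
  | nil => exact measurable_const
  | append_singleton ω i ih =>
    simp only [amp_concat]
    have h1 : Measurable[past y (ω ++ [i]).length] (y ω) := measurable_past (by simp)
    have h2 : Measurable[past y (ω ++ [i]).length] fun θ => amp (fun τ => y τ θ) ω :=
      ih.mono (past_mono (by simp)) le_rfl
    exact h2.mul (((measurable_pi_apply _).comp h1).sub ((measurable_pi_apply _).comp h1))

variable [MeasurableSpace Θ] {P : Measure Θ}

/-- The heights `y ω`, for words `ω`, are independent and identically distributed. -/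
structure IsRandomTree (P : Measure Θ) (y : List (Fin m) → Θ → Fin (m + 1) → ℝ) : Prop where
  measurable : ∀ ω, Measurable (y ω)
  indep : iIndepFun y P
  ident : ∀ ω, IdentDistrib (y ω) (y []) P P
  heights : ∀ ω θ, IsHeights (y ω θ)

/-- The absolute increment of the heights over the cell `i`. -/
abbrev gap (i : Fin m) (v : Fin (m + 1) → ℝ) : ℝ := |v i.succ - v i.castSucc|

theorem measurable_gap (i : Fin m) : Measurable (gap i) := by unfold gap; fun_prop

theorem past_le (hy : IsRandomTree P y) (n : ℕ) : past y n ≤ ‹MeasurableSpace Θ› :=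
  iSup₂_le fun τ _ => (hy.measurable τ).comap_le

theorem indep_past (hy : IsRandomTree P y) (ω : List (Fin m)) :
    Indep (past y ω.length) (MeasurableSpace.comap (y ω) inferInstance) P := by
  have h := indep_iSup_of_disjoint (fun τ => (hy.measurable τ).comap_le) hy.indep
    (S := {τ : List (Fin m) | τ.length < ω.length}) (T := {ω}) (by simp)
  simpa [past] using h

theorem measurable_amp (hy : IsRandomTree P y) (ω : List (Fin m)) :
    Measurable fun θ => amp (fun τ => y τ θ) ω :=
  (measurable_past_amp ω).mono (past_le hy _) le_rfl

theorem lintegral_past_mul (hy : IsRandomTree P y) {ω : List (Fin m)} {Z : Θ → ENNReal}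
    (hZ : Measurable[past y ω.length] Z) {g : (Fin (m + 1) → ℝ) → ENNReal} (hg : Measurable g) :
    ∫⁻ θ, Z θ * g (y ω θ) ∂P = (∫⁻ θ, Z θ ∂P) * ∫⁻ θ, g (y [] θ) ∂P := by
  refine (lintegral_mul_eq_lintegral_mul_lintegral_of_independent_measurableSpace (past_le hy _)
    (hy.measurable ω).comap_le (indep_past hy ω) hZ (hg.comp (comap_measurable _))).trans ?_
  congr 1
  exact ((hy.ident ω).comp hg).lintegral_eq

/-- First-moment computation for a multiplicative cascade: `f ω` depends on the past of `ω` only, so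
each new letter multiplies the expected total by `∑ E g i`. -/
theorem lintegral_sum_words [IsProbabilityMeasure P] (hy : IsRandomTree P y)
    {g : Fin m → (Fin (m + 1) → ℝ) → ENNReal} (hg : ∀ i, Measurable (g i))
    {f : List (Fin m) → Θ → ENNReal} (h0 : ∀ θ, f [] θ = 1)
    (hf : ∀ ω i θ, f (ω ++ [i]) θ = f ω θ * g i (y ω θ)) :
    (∀ ω, Measurable[past y ω.length] (f ω)) ∧
    ∀ n, ∫⁻ θ, ∑ ω ∈ words m n, f ω θ ∂P = (∑ i, ∫⁻ θ, g i (y [] θ) ∂P) ^ n := by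
  have hfm : ∀ ω, Measurable[past y ω.length] (f ω) := by
    intro ω
    induction ω using List.reverseRecOn with
    | nil => rw [show f [] = fun _ => 1 from funext h0]; exact measurable_const
    | append_singleton ω i ih =>
      rw [show f (ω ++ [i]) = fun θ => f ω θ * g i (y ω θ) from funext (hf ω i)]
      exact (ih.mono (past_mono (by simp)) le_rfl).mul ((hg i).comp (measurable_past (by simp)))
  have hfm' : ∀ ω, Measurable (f ω) := fun ω => (hfm ω).mono (past_le hy _) le_rfl
  refine ⟨hfm, fun n => ?_⟩
  rw [lintegral_finsetSum _ fun ω _ => hfm' ω]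
  induction n with
  | zero => simp [sum_words_zero, h0]
  | succ n ih =>
    rw [sum_words_succ, pow_succ, ← ih, Finset.sum_mul]
    refine Finset.sum_congr rfl fun ω _ => ?_
    rw [Finset.mul_sum]
    refine Finset.sum_congr rfl fun i _ => ?_
    simp only [hf]
    exact lintegral_past_mul hy (hfm ω) (hg i)

theorem ae_tsum_words_ne_top [IsProbabilityMeasure P] (hy : IsRandomTree P y)
    {g : Fin m → (Fin (m + 1) → ℝ) → ENNReal} (hg : ∀ i, Measurable (g i))
    {f : List (Fin m) → Θ → ENNReal} (h0 : ∀ θ, f [] θ = 1)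
    (hf : ∀ ω i θ, f (ω ++ [i]) θ = f ω θ * g i (y ω θ))
    (hlt : ∑ i, ∫⁻ θ, g i (y [] θ) ∂P < 1) :
    ∀ᵐ θ ∂P, ∑' n, ∑ ω ∈ words m n, f ω θ ≠ ⊤ := by
  obtain ⟨hfm, h⟩ := lintegral_sum_words hy hg h0 hf
  have hm : ∀ n, Measurable fun θ => ∑ ω ∈ words m n, f ω θ := fun n =>
    Finset.measurable_fun_sum _ fun ω _ => (hfm ω).mono (past_le hy _) le_rfl
  have hfin : ∫⁻ θ, ∑' n, ∑ ω ∈ words m n, f ω θ ∂P ≠ ⊤ := by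
    rw [lintegral_tsum fun n => (hm n).aemeasurable]
    simp only [h]
    rw [ENNReal.tsum_geometric]
    exact ENNReal.inv_ne_top.2 (tsub_pos_of_lt hlt).ne'
  filter_upwards [ae_lt_top (Measurable.tsum hm) hfin] with θ hθ using hθ.ne

theorem shrinks_of_tsum_ne_top {u : List (Fin m) → Fin (m + 1) → ℝ} {s : ℕ}
    (h : ∑' n, ∑ ω ∈ words m n, ENNReal.ofReal |amp u ω| ^ s ≠ ⊤) : Shrinks u := by
  intro ε hε
  have h1 := ENNReal.tendsto_atTop_zero_of_tsum_ne_top h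
  have hpos : 0 < ENNReal.ofReal ε ^ s := ENNReal.pow_pos (ENNReal.ofReal_pos.2 hε) s
  obtain ⟨n, hn⟩ := (h1.eventually_lt_const hpos).exists
  refine ⟨n, fun ω hω => ?_⟩
  have h2 : ENNReal.ofReal |amp u ω| ^ s < ENNReal.ofReal ε ^ s :=
    (Finset.single_le_sum (f := fun ω => ENNReal.ofReal |amp u ω| ^ s) (fun _ _ => zero_le)
      (mem_words.2 hω)).trans_lt hn
  exact ((ENNReal.ofReal_lt_ofReal_iff hε).1 (lt_of_pow_lt_pow_left' s h2)).le

/-- Since `m ≥ 2`, every cell has an interior node as an endpoint; its height lies in `(0, 1)` and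
the other one in `[0, 1]`. -/
theorem ae_gap_lt_one (hm : 2 ≤ m) (hy : IsRandomTree P y)
    (hnondeg : ∀ i : Fin (m + 1), i ≠ 0 → i ≠ Fin.last m →
      P {θ | y [] θ i = 0 ∨ y [] θ i = 1} = 0) (i : Fin m) :
    ∀ᵐ θ ∂P, gap i (y [] θ) < 1 := by
  have key : ∀ j : Fin (m + 1), j ≠ 0 → j ≠ Fin.last m → ∀ᵐ θ ∂P, y [] θ j ∈ Ioo (0 : ℝ) 1 := by
    intro j h0 h1
    have h : ∀ᵐ θ ∂P, ¬ (y [] θ j = 0 ∨ y [] θ j = 1) := by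
      rw [ae_iff]; simpa only [not_not] using hnondeg j h0 h1
    filter_upwards [h] with θ hθ
    rw [not_or] at hθ
    have := (hy.heights [] θ).mem j
    exact ⟨lt_of_le_of_ne this.1 (Ne.symm hθ.1), lt_of_le_of_ne this.2 hθ.2⟩
  by_cases h0 : (i : ℕ) = 0
  · have h1 : i.succ ≠ Fin.last m := by
      intro h
      have := congrArg Fin.val h
      simp at this
      omega
    filter_upwards [key i.succ (Fin.succ_ne_zero i) h1] with θ hθ
    have := (hy.heights [] θ).mem i.castSucc
    rw [abs_lt]
    constructor <;> linarith [this.1, this.2, hθ.1, hθ.2]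
  · have h1 : i.castSucc ≠ 0 := by
      intro h
      have := congrArg Fin.val h
      simp at this
      omega
    filter_upwards [key i.castSucc h1 (Fin.castSucc_ne_last i)] with θ hθ
    have := (hy.heights [] θ).mem i.succ
    rw [abs_lt]
    constructor <;> linarith [this.1, this.2, hθ.1, hθ.2]

/-- By dominated convergence `∑ E aᵢ^s → 0` as `s → ∞`, so some power gives a subcritical cascade
with almost surely finite total. -/
theorem ae_shrinks [IsProbabilityMeasure P] (hy : IsRandomTree P y)
    (hlt : ∀ i : Fin m, ∀ᵐ θ ∂P, gap i (y [] θ) < 1) :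
    ∀ᵐ θ ∂P, Shrinks fun τ => y τ θ := by
  have hgm : ∀ i : Fin m, Measurable fun v => ENNReal.ofReal (gap i v) :=
    fun i => (measurable_gap i).ennreal_ofReal
  have hlim : Filter.Tendsto (fun s : ℕ => ∑ i : Fin m, ∫⁻ θ, ENNReal.ofReal (gap i (y [] θ)) ^ s ∂P)
      Filter.atTop (nhds (∑ _i : Fin m, ∫⁻ _, 0 ∂P)) := by
    refine tendsto_finsetSum _ fun i _ => ?_
    refine tendsto_lintegral_of_dominated_convergence (fun _ => 1)
      (fun s => ((hgm i).comp (hy.measurable [])).pow_const s) ?_ (by simp) ?_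
    · intro s
      filter_upwards with θ
      exact pow_le_one₀ zero_le
        (ENNReal.ofReal_le_one.2 ((hy.heights [] θ).abs_sub_le _ _))
    · filter_upwards [hlt i] with θ hθ
      exact ENNReal.tendsto_pow_atTop_nhds_zero_of_lt_one (by simpa using hθ)
  rw [show ∑ _i : Fin m, ∫⁻ _, 0 ∂P = (0 : ENNReal) by simp] at hlim
  obtain ⟨s, hs1⟩ := (hlim.eventually_lt_const one_pos).exists
  filter_upwards [ae_tsum_words_ne_top hy (g := fun i v => ENNReal.ofReal (gap i v) ^ s)
    (f := fun ω θ => ENNReal.ofReal |amp (fun τ => y τ θ) ω| ^ s)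
    (fun i => (hgm i).pow_const s) (by simp [amp])
    (fun ω i θ => by rw [amp_concat, abs_mul, ENNReal.ofReal_mul (abs_nonneg _), mul_pow]) hs1]
    with θ hθ
  exact shrinks_of_tsum_ne_top hθ

end

/-! ### The drift `φ` and the case `φ < 0`. -/

section

variable {m : ℕ} {b : Fin (m + 1) → ℝ} {Θ : Type*} {y : List (Fin m) → Θ → Fin (m + 1) → ℝ}
  [MeasurableSpace Θ] {P : Measure Θ}

/-- The negative logarithm of a number of `[0, 1]`, with value `⊤` at `0`. -/
noncomputable def negLog (a : ℝ) : ENNReal := (-(ENNReal.log (ENNReal.ofReal a))).toENNReal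

theorem negLog_of_pos {a : ℝ} (ha : 0 < a) : negLog a = ENNReal.ofReal (-Real.log a) := by
  rw [negLog, ENNReal.log_ofReal_of_pos ha, ← EReal.coe_neg, EReal.real_coe_toENNReal]

theorem negLog_zero : negLog 0 = ⊤ := by simp [negLog]

theorem measurable_negLog : Measurable negLog := by unfold negLog; fun_prop

theorem extExpectation_log (hy : IsRandomTree P y) (i : Fin m) :
    extExpectation P
        (fun θ => ENNReal.log (ENNReal.ofReal |y [] θ i.succ - y [] θ i.castSucc|)) =
      -((∫⁻ θ, negLog (gap i (y [] θ)) ∂P : ENNReal) : EReal) := by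
  have h : ∀ θ, (ENNReal.log (ENNReal.ofReal
      |y [] θ i.succ - y [] θ i.castSucc|)).toENNReal = 0 := by
    intro θ
    refine EReal.toENNReal_of_nonpos ?_
    rw [ENNReal.log_le_zero_iff, ENNReal.ofReal_le_one]
    exact (hy.heights [] θ).abs_sub_le _ _
  simp only [extExpectation, h, lintegral_zero, negLog]
  simp

/-- The logarithmic gaps of the first level are almost surely finite and integrable. -/
def LogIntegrable (P : Measure Θ) (v : Θ → Fin (m + 1) → ℝ) : Prop :=
  ∀ i : Fin m, (∀ᵐ θ ∂P, 0 < gap i (v θ)) ∧ Integrable (fun θ => Real.log (gap i (v θ))) P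

theorem phi_eq_of_logIntegrable (hy : IsRandomTree P y) (h : LogIntegrable P (y [])) :
    phi P b (y []) = ((∑ i : Fin m, (b i.succ - b i.castSucc) *
      (∫ θ, Real.log (gap i (y [] θ)) ∂P - Real.log (b i.succ - b i.castSucc)) : ℝ) : EReal) := by
  rw [phi]
  let c : ℝ →+ EReal := ⟨⟨Real.toEReal, EReal.coe_zero⟩, EReal.coe_add⟩
  refine Eq.trans ?_ (map_sum c _ _).symm
  refine Finset.sum_congr rfl fun i _ => ?_
  change _ = Real.toEReal _
  have h1 : ∫⁻ θ, negLog (gap i (y [] θ)) ∂P =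
      ENNReal.ofReal (-∫ θ, Real.log (gap i (y [] θ)) ∂P) := by
    have h2 : 0 ≤ᵐ[P] fun θ => -Real.log (gap i (y [] θ)) := by
      filter_upwards with θ
      exact neg_nonneg.2 (Real.log_nonpos (abs_nonneg _) ((hy.heights [] θ).abs_sub_le _ _))
    have hn : Integrable (fun θ => -Real.log (gap i (y [] θ))) P := (h i).2.neg
    rw [← integral_neg, ofReal_integral_eq_lintegral_ofReal hn h2]
    refine lintegral_congr_ae ?_
    filter_upwards [(h i).1] with θ hθ using negLog_of_pos hθ
  have h3 : 0 ≤ -∫ θ, Real.log (gap i (y [] θ)) ∂P := by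
    rw [← integral_neg]
    exact integral_nonneg fun θ =>
      neg_nonneg.2 (Real.log_nonpos (abs_nonneg _) ((hy.heights [] θ).abs_sub_le _ _))
  rw [extExpectation_log hy, h1, EReal.coe_ennreal_ofReal, max_eq_left h3, ← EReal.coe_neg,
    neg_neg, ← EReal.coe_sub, ← EReal.coe_mul]

theorem logIntegrable_of_lintegral_ne_top (hy : IsRandomTree P y)
    (h : ∀ i : Fin m, ∫⁻ θ, negLog (gap i (y [] θ)) ∂P ≠ ⊤) : LogIntegrable P (y []) := by
  intro i
  have hgm : Measurable fun θ => gap i (y [] θ) := (measurable_gap i).comp (hy.measurable [])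
  have hpos : ∀ᵐ θ ∂P, 0 < gap i (y [] θ) := by
    filter_upwards [ae_lt_top (measurable_negLog.comp hgm) (h i)] with θ hθ
    refine lt_of_le_of_ne (abs_nonneg _) fun h0 => ?_
    rw [Function.comp_apply, ← h0, negLog_zero] at hθ
    exact hθ.ne rfl
  refine ⟨hpos, ?_⟩
  have h2 : 0 ≤ᵐ[P] fun θ => -Real.log (gap i (y [] θ)) := by
    filter_upwards with θ
    exact neg_nonneg.2 (Real.log_nonpos (abs_nonneg _) ((hy.heights [] θ).abs_sub_le _ _))
  rw [← integrable_neg_iff]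
  refine ⟨(Real.measurable_log.comp hgm).neg.aestronglyMeasurable, ?_⟩
  refine (hasFiniteIntegral_iff_ofReal h2).2 ?_
  rw [lintegral_congr_ae (g := fun θ => negLog (gap i (y [] θ)))]
  · exact (h i).lt_top
  · filter_upwards [hpos] with θ hθ using (negLog_of_pos hθ).symm

/-- One infinite logarithmic moment makes its summand `⊥`, and in `EReal` a sum with a term `⊥` is
`⊥`. -/
theorem logIntegrable_of_phi_nonneg (hb : IsPartition b) (hy : IsRandomTree P y)
    (h : 0 ≤ phi P b (y [])) : LogIntegrable P (y []) := by
  refine logIntegrable_of_lintegral_ne_top hy fun i hi => ?_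
  have hbot : phi P b (y []) = ⊥ := by
    rw [phi, ← Finset.add_sum_erase _ _ (Finset.mem_univ i), extExpectation_log hy, hi,
      EReal.coe_ennreal_top, EReal.neg_top, EReal.bot_sub, EReal.coe_mul_bot_of_pos (hb.sub_pos i),
      EReal.bot_add]
  rw [hbot] at h
  exact absurd h (by simp)

/-- Bernoulli's inequality. It keeps `1 - l * (s⁻¹ * (t ^ s - 1))` nonnegative when `l * t ≤ 1`, as
Fatou's lemma requires. -/
theorem inv_mul_rpow_sub_one_le {t s : ℝ} (ht : 0 ≤ t) (hs0 : 0 < s) (hs1 : s ≤ 1) :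
    s⁻¹ * (t ^ s - 1) ≤ t := by
  have h := rpow_one_add_le_one_add_mul_self (s := t - 1) (by linarith) hs0.le hs1
  rw [add_sub_cancel] at h
  rw [inv_mul_le_iff₀ hs0]
  nlinarith

/-- `(t ^ s - 1) / s → log t` as `s → 0`. The value `⊤` when some `t i = 0` reflects `log 0 = -∞`,
which `Real.log` does not. -/
theorem tendsto_ofReal_sub_sum {l t : Fin m → ℝ} (hl : ∀ i, 0 < l i) (ht : ∀ i, 0 ≤ t i)
    (htl : ∀ i, l i * t i ≤ 1) :
    Filter.Tendsto (fun s : ℝ => ENNReal.ofReal (∑ i, (1 - l i * (s⁻¹ * (t i ^ s - 1)))))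
      (nhdsWithin 0 (Ioi 0))
      (nhds (if ∀ i, 0 < t i then ENNReal.ofReal (∑ i, (1 - l i * Real.log (t i))) else ⊤)) := by
  split_ifs with h
  · refine ENNReal.tendsto_ofReal (tendsto_finsetSum _ fun i _ => ?_)
    exact ((tendsto_rpow_sub_one_log (h i)).const_mul _).const_sub _
  · push Not at h
    obtain ⟨i, hi⟩ := h
    have hi0 : t i = 0 := le_antisymm hi (ht i)
    refine ENNReal.tendsto_ofReal_atTop.comp ?_
    refine Filter.tendsto_atTop_mono' _ ?_
      (Filter.Tendsto.const_mul_atTop (hl i) tendsto_inv_nhdsGT_zero)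
    filter_upwards [Ioc_mem_nhdsGT one_pos] with s hs
    have hterm : ∀ j, 0 ≤ 1 - l j * (s⁻¹ * (t j ^ s - 1)) := by
      intro j
      have := mul_le_mul_of_nonneg_left (inv_mul_rpow_sub_one_le (ht j) hs.1 hs.2) (hl j).le
      linarith [htl j]
    refine le_trans ?_ (Finset.single_le_sum (f := fun i => 1 - l i * (s⁻¹ * (t i ^ s - 1)))
      (fun j _ => hterm j) (Finset.mem_univ i))
    simp only [hi0, Real.zero_rpow hs.1.ne']
    linarith

/-- If all moments were at least `1`, the integrals of `∑ (1 - lᵢ (tᵢ^s - 1)/s)` would be at most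
`m`. Fatou's lemma as `s → 0` then yields both integrability of the logarithms and `φ ≥ 0`. Thus the
case `φ = -∞` needs no separate treatment. -/
theorem exists_moment_lt_one [IsProbabilityMeasure P] (hb : IsPartition b)
    (hy : IsRandomTree P y) (hphi : phi P b (y []) < 0) :
    ∃ s : ℝ, 0 < s ∧ ∑ i : Fin m, ∫⁻ θ, ENNReal.ofReal ((b i.succ - b i.castSucc) *
      (gap i (y [] θ) / (b i.succ - b i.castSucc)) ^ s) ∂P < 1 := by
  by_contra! hcon
  set l : Fin m → ℝ := fun i => b i.succ - b i.castSucc with hl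
  set t : Θ → Fin m → ℝ := fun θ i => gap i (y [] θ) / l i with ht
  have hl0 : ∀ i, 0 < l i := hb.sub_pos
  have hlsum : ∑ i, l i = 1 := sum_sub_eq_one hb.isHeights
  have ht0 : ∀ θ i, 0 ≤ t θ i := fun θ i => div_nonneg (abs_nonneg _) (hl0 i).le
  have hgt : ∀ θ i, l i * t θ i = gap i (y [] θ) := fun θ i => mul_div_cancel₀ _ (hl0 i).ne'
  have htl : ∀ θ i, l i * t θ i ≤ 1 := fun θ i =>
    (hgt θ i).trans_le ((hy.heights [] θ).abs_sub_le _ _)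
  have htm : ∀ i, Measurable fun θ => t θ i := fun i =>
    ((measurable_gap i).comp (hy.measurable [])).div_const _
  have hterm : ∀ θ, ∀ s ∈ Ioc (0 : ℝ) 1, ∀ i, 0 ≤ 1 - l i * (s⁻¹ * (t θ i ^ s - 1)) := by
    intro θ s hs i
    have := mul_le_mul_of_nonneg_left (inv_mul_rpow_sub_one_le (ht0 θ i) hs.1 hs.2) (hl0 i).le
    linarith [htl θ i]
  have hrpow : ∀ s ∈ Ioc (0 : ℝ) 1, ∀ i, Integrable (fun θ => t θ i ^ s) P := by
    intro s hs i
    refine Integrable.of_bound (C := ((l i)⁻¹) ^ s)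
      ((htm i).pow_const s).aestronglyMeasurable ?_
    filter_upwards with θ
    rw [Real.norm_of_nonneg (Real.rpow_nonneg (ht0 θ i) s)]
    refine Real.rpow_le_rpow (ht0 θ i) ?_ hs.1.le
    rw [← one_div, le_div_iff₀' (hl0 i)]
    exact htl θ i
  have hbound : ∀ s ∈ Ioc (0 : ℝ) 1,
      ∫⁻ θ, ENNReal.ofReal (∑ i, (1 - l i * (s⁻¹ * (t θ i ^ s - 1)))) ∂P ≤ ENNReal.ofReal m := by
    intro s hs
    have hint : ∀ i, Integrable (fun θ => 1 - l i * (s⁻¹ * (t θ i ^ s - 1))) P := fun i =>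
      (integrable_const _).sub ((((hrpow s hs i).sub (integrable_const _)).const_mul _).const_mul _)
    rw [← ofReal_integral_eq_lintegral_ofReal (integrable_finsetSum _ fun i _ => hint i)
      (Filter.Eventually.of_forall fun θ => Finset.sum_nonneg fun i _ => hterm θ s hs i)]
    refine ENNReal.ofReal_le_ofReal ?_
    rw [integral_finsetSum _ fun i _ => hint i]
    have h1 : ∀ i, ∫ θ, (1 - l i * (s⁻¹ * (t θ i ^ s - 1))) ∂P =
        1 - s⁻¹ * (l i * ∫ θ, t θ i ^ s ∂P - l i) := by
      intro i
      have hd : Integrable (fun θ => t θ i ^ s - 1) P := (hrpow s hs i).sub (integrable_const _)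
      rw [integral_sub (integrable_const _) ((hd.const_mul _).const_mul _),
        integral_const_mul, integral_const_mul, integral_sub (hrpow s hs i) (integrable_const _)]
      simp
      ring
    simp only [h1, Finset.sum_sub_distrib, ← Finset.mul_sum, hlsum]
    have h2 : 1 ≤ ∑ i, l i * ∫ θ, t θ i ^ s ∂P := by
      have h3 := hcon s hs.1
      have h4 : ∀ i, ∫⁻ θ, ENNReal.ofReal (l i * t θ i ^ s) ∂P =
          ENNReal.ofReal (l i * ∫ θ, t θ i ^ s ∂P) := by
        intro i
        rw [← integral_const_mul, ofReal_integral_eq_lintegral_ofReal ((hrpow s hs i).const_mul _)]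
        exact Filter.Eventually.of_forall fun θ =>
          mul_nonneg (hl0 i).le (Real.rpow_nonneg (ht0 θ i) s)
      rw [Finset.sum_congr rfl fun i _ => h4 i, ← ENNReal.ofReal_sum_of_nonneg,
        ENNReal.one_le_ofReal] at h3
      · exact h3
      · exact fun i _ => mul_nonneg (hl0 i).le
          (integral_nonneg fun θ => Real.rpow_nonneg (ht0 θ i) s)
    have h5 : 0 ≤ s⁻¹ * (∑ i, l i * ∫ θ, t θ i ^ s ∂P - 1) :=
      mul_nonneg (inv_nonneg.2 hs.1.le) (by linarith)
    simp
    linarith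
  have hfatou := lintegral_liminf_le (μ := P) (u := nhdsWithin (0 : ℝ) (Ioi 0))
    (f := fun s θ => ENNReal.ofReal (∑ i, (1 - l i * (s⁻¹ * (t θ i ^ s - 1)))))
    (fun s => (Finset.measurable_fun_sum _ fun i _ =>
      ((((htm i).pow_const s).sub_const _).const_mul _).const_mul _ |>.const_sub _).ennreal_ofReal)
  have hlim := fun θ => (tendsto_ofReal_sub_sum hl0 (ht0 θ) (htl θ)).liminf_eq
  simp only [hlim] at hfatou
  have hle : ∫⁻ θ, (if ∀ i, 0 < t θ i then ENNReal.ofReal (∑ i, (1 - l i * Real.log (t θ i)))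
      else ⊤) ∂P ≤ ENNReal.ofReal m := by
    refine hfatou.trans ?_
    refine (Filter.liminf_le_liminf (v := fun _ => ENNReal.ofReal m) ?_).trans
      (Filter.liminf_const _).le
    filter_upwards [Ioc_mem_nhdsGT one_pos] with s hs using hbound s hs
  have hlog : ∀ θ i, 0 < t θ i → 0 ≤ 1 - l i * Real.log (t θ i) := by
    intro θ i h
    have := mul_le_mul_of_nonneg_left (Real.log_le_sub_one_of_pos h) (hl0 i).le
    linarith [htl θ i, hl0 i]
  have hmeas : Measurable fun θ => (if ∀ i, 0 < t θ i then
      ENNReal.ofReal (∑ i, (1 - l i * Real.log (t θ i))) else ⊤) := by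
    refine Measurable.ite ?_ ?_ measurable_const
    · rw [show {θ | ∀ i, 0 < t θ i} = ⋂ i, {θ | 0 < t θ i} by ext; simp]
      exact MeasurableSet.iInter fun i => measurableSet_lt measurable_const (htm i)
    · exact (Finset.measurable_fun_sum _ fun i _ =>
        ((Real.measurable_log.comp (htm i)).const_mul _).const_sub _).ennreal_ofReal
  have htpos : ∀ᵐ θ ∂P, ∀ i, 0 < t θ i := by
    filter_upwards [ae_lt_top hmeas (hle.trans_lt ENNReal.ofReal_lt_top).ne] with θ hθ
    by_contra h
    rw [if_neg h] at hθ
    exact hθ.ne rfl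
  have hle' : ∫⁻ θ, ENNReal.ofReal (∑ i, (1 - l i * Real.log (t θ i))) ∂P ≤ ENNReal.ofReal m := by
    refine le_trans (lintegral_mono_ae ?_) hle
    filter_upwards [htpos] with θ hθ
    rw [if_pos hθ]
  -- The summands are nonnegative, so the finite integral of the sum controls each of them.
  have hlogt : ∀ i, Integrable (fun θ => Real.log (t θ i)) P := by
    intro i
    have h1 : Integrable (fun θ => 1 - l i * Real.log (t θ i)) P := by
      refine ⟨(((Real.measurable_log.comp (htm i)).const_mul _).const_sub
        _).aestronglyMeasurable, ?_⟩
      refine (hasFiniteIntegral_iff_ofReal ?_).2 ((lintegral_mono_ae ?_).trans_lt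
        (hle'.trans_lt ENNReal.ofReal_lt_top))
      · filter_upwards [htpos] with θ hθ using hlog θ i (hθ i)
      · filter_upwards [htpos] with θ hθ
        exact ENNReal.ofReal_le_ofReal (Finset.single_le_sum
          (f := fun i => 1 - l i * Real.log (t θ i)) (fun j _ => hlog θ j (hθ j))
          (Finset.mem_univ i))
    have h2 := ((integrable_const (1 : ℝ)).sub h1).const_mul (l i)⁻¹
    refine h2.congr (Filter.Eventually.of_forall fun θ => ?_)
    simp only [Pi.sub_apply, sub_sub_cancel]
    rw [inv_mul_cancel_left₀ (hl0 i).ne']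
  have hgpos : ∀ i, ∀ᵐ θ ∂P, 0 < gap i (y [] θ) := by
    intro i
    filter_upwards [htpos] with θ hθ
    rw [← hgt]
    exact mul_pos (hl0 i) (hθ i)
  have hsplit : ∀ i, (fun θ => Real.log (gap i (y [] θ))) =ᵐ[P]
      fun θ => Real.log (t θ i) + Real.log (l i) := by
    intro i
    filter_upwards [htpos] with θ hθ
    rw [← hgt, Real.log_mul (hl0 i).ne' (hθ i).ne', add_comm]
  have hLI : LogIntegrable P (y []) := fun i =>
    ⟨hgpos i, ((hlogt i).add (integrable_const _)).congr (hsplit i).symm⟩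
  rw [phi_eq_of_logIntegrable hy hLI, ← EReal.coe_zero, EReal.coe_lt_coe_iff] at hphi
  have hI : ∀ i, ∫ θ, Real.log (gap i (y [] θ)) ∂P - Real.log (l i) =
      ∫ θ, Real.log (t θ i) ∂P := by
    intro i
    rw [integral_congr_ae (hsplit i), integral_add (hlogt i) (integrable_const _)]
    simp
  have hint : ∀ i, Integrable (fun θ => 1 - l i * Real.log (t θ i)) P := fun i =>
    (integrable_const _).sub ((hlogt i).const_mul _)
  rw [← ofReal_integral_eq_lintegral_ofReal (integrable_finsetSum _ fun i _ => hint i)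
    (by filter_upwards [htpos] with θ hθ
        exact Finset.sum_nonneg fun i _ => hlog θ i (hθ i)),
    ENNReal.ofReal_le_ofReal_iff (Nat.cast_nonneg _), integral_finsetSum _ fun i _ => hint i] at hle'
  have h6 : ∀ i, ∫ θ, (1 - l i * Real.log (t θ i)) ∂P =
      1 - l i * (∫ θ, Real.log (gap i (y [] θ)) ∂P - Real.log (l i)) := by
    intro i
    rw [integral_sub (integrable_const _) ((hlogt i).const_mul _), integral_const_mul, hI]
    simp
  simp only [h6, Finset.sum_sub_distrib] at hle'
  simp only [Finset.sum_const, Finset.card_univ, Fintype.card_fin, nsmul_eq_mul, mul_one] at hle'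
  linarith

theorem ae_hasDerivWithinAt_zero [IsProbabilityMeasure P] (hb : IsPartition b) (hm : 0 < m)
    (hy : IsRandomTree P y) (hs : ∀ᵐ θ ∂P, Shrinks fun τ => y τ θ) (hphi : phi P b (y []) < 0) :
    ∀ᵐ θ ∂P, ∀ᵐ x ∂(volume.restrict (Icc (0 : ℝ) 1)),
      HasDerivWithinAt (graphFun b (fun ω => y ω θ)) 0 (Icc (0 : ℝ) 1) x := by
  obtain ⟨s, hs0, hlt⟩ := exists_moment_lt_one hb hy hphi
  -- A number `q` strictly between the moment and `1` leaves room: the cascade stays subcritical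
  -- after division by `q ^ n`.
  obtain ⟨q', hq1, hq2⟩ := ENNReal.lt_iff_exists_nnreal_btwn.1 hlt
  have hq0 : (0 : ℝ) < q' := NNReal.coe_pos.2 (ENNReal.coe_pos.1 (bot_le.trans_lt hq1))
  have hq3 : (q' : ℝ) < 1 := by exact_mod_cast hq2
  set q : ℝ := (q' : ℝ)
  have hsum : ∑ i : Fin m, ∫⁻ θ, ENNReal.ofReal ((b i.succ - b i.castSucc) *
      (gap i (y [] θ) / (b i.succ - b i.castSucc)) ^ s / q) ∂P < 1 := by
    have h1 : ∀ i : Fin m, ∫⁻ θ, ENNReal.ofReal ((b i.succ - b i.castSucc) *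
        (gap i (y [] θ) / (b i.succ - b i.castSucc)) ^ s / q) ∂P =
        (∫⁻ θ, ENNReal.ofReal ((b i.succ - b i.castSucc) *
          (gap i (y [] θ) / (b i.succ - b i.castSucc)) ^ s) ∂P) / q' := by
      intro i
      simp only [ENNReal.ofReal_div_of_pos hq0, ENNReal.div_eq_inv_mul]
      rw [lintegral_const_mul', ENNReal.ofReal_coe_nnreal]
      rw [ENNReal.ofReal_coe_nnreal]
      exact ENNReal.inv_ne_top.2 (ENNReal.coe_ne_zero.2 (NNReal.coe_ne_zero.1 hq0.ne'))
    simp only [h1, ENNReal.div_eq_inv_mul, ← Finset.mul_sum]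
    rw [← ENNReal.div_eq_inv_mul]
    refine ENNReal.div_lt_of_lt_mul ?_
    rwa [one_mul]
  have htsum := ae_tsum_words_ne_top hy
    (g := fun i v => ENNReal.ofReal ((b i.succ - b i.castSucc) *
      (gap i v / (b i.succ - b i.castSucc)) ^ s / q))
    (f := fun ω θ => ENNReal.ofReal (len b ω * (|amp (fun τ => y τ θ) ω| / len b ω) ^ s /
      q ^ ω.length))
    (fun i => (((((measurable_gap i).div_const _).pow_const s).const_mul _).div_const
      _).ennreal_ofReal)
    (by simp [amp])
    (fun ω i θ => by
      have hl := hb.sub_pos i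
      have hL := len_pos hb ω
      rw [← ENNReal.ofReal_mul (by positivity), amp_concat, len_concat, abs_mul,
        mul_div_mul_comm, Real.mul_rpow (by positivity) (by positivity), List.length_append,
        List.length_singleton, pow_succ]
      congr 1
      field_simp) hsum
  -- With `δ ^ (2 * s) = q`, a slope above `δ ^ (2 * n)` has `s`-th power above `q ^ n`, so the
  -- weight of the word dominates its length.
  set δ : ℝ := q ^ (1 / (2 * s)) with hδ
  have hδ0 : 0 < δ := Real.rpow_pos_of_pos hq0 _
  have hδ1 : δ < 1 := Real.rpow_lt_one hq0.le hq3 (by positivity)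
  have hδq : ∀ n : ℕ, (δ ^ (2 * n)) ^ s = q ^ n := by
    intro n
    rw [hδ, ← Real.rpow_natCast, ← Real.rpow_mul hq0.le, ← Real.rpow_mul hq0.le,
      ← Real.rpow_natCast]
    congr 1
    push_cast
    field_simp
  filter_upwards [htsum, hs] with θ hθ hsθ
  rw [ae_restrict_iff' measurableSet_Icc]
  have hflat := ae_flat hb hδ0 hδ1 _ (u := fun τ => y τ θ) (fun ω hω => ?_) hθ
  · filter_upwards [hflat] with x hx hxI
    exact hasDerivWithinAt_zero_of_flat hb (fun τ => hy.heights τ θ) hm hsθ hxI hδ0 hδ1 hx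
  · refine ENNReal.ofReal_le_ofReal ?_
    have hL := len_pos hb ω
    rw [le_div_iff₀ (by positivity)]
    refine mul_le_mul_of_nonneg_left ?_ hL.le
    rw [← hδq]
    exact Real.rpow_le_rpow (by positivity) ((le_div_iff₀ hL).2 hω.le) hs0.le

end

/-! ### Alive words, the potential and the strict inequality `∑ E aᵢ > 1`. -/

section

variable {m : ℕ} {b : Fin (m + 1) → ℝ} {Θ : Type*} {y : List (Fin m) → Θ → Fin (m + 1) → ℝ}

theorem measurable_past_abs_amp (ω : List (Fin m)) :
    Measurable[past y ω.length] fun θ => |amp (fun τ => y τ θ) ω| :=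
  continuous_abs.measurable.comp (measurable_past_amp ω)

theorem measurableSet_past_alive (K : ℝ) (ω : List (Fin m)) :
    MeasurableSet[past y ω.length] {θ | Alive b K (fun τ => y τ θ) ω} := by
  induction ω using List.reverseRecOn with
  | nil =>
    have h : ∀ θ, Alive b K (fun τ => y τ θ) [] ↔ 1 ≤ K := fun θ => by simp [Alive, amp]
    simp only [h]
    exact MeasurableSet.const _
  | append_singleton ω i ih =>
    simp only [alive_concat]
    have h1 : MeasurableSet[past y (ω ++ [i]).length] {θ | Alive b K (fun τ => y τ θ) ω} :=
      past_mono (by simp) _ ih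
    have h2 : MeasurableSet[past y (ω ++ [i]).length]
        {θ | |amp (fun τ => y τ θ) (ω ++ [i])| ≤ K * len b (ω ++ [i])} :=
      measurable_past_abs_amp (ω ++ [i]) measurableSet_Iic
    exact h1.inter h2

open Classical in
/-- The indicator of the event that `ω` is alive. -/
noncomputable def aliveInd (b : Fin (m + 1) → ℝ) (K : ℝ)
    (y : List (Fin m) → Θ → Fin (m + 1) → ℝ) (ω : List (Fin m)) (θ : Θ) : ℝ :=
  if Alive b K (fun τ => y τ θ) ω then 1 else 0

theorem aliveInd_nonneg (K : ℝ) (ω : List (Fin m)) (θ : Θ) : 0 ≤ aliveInd b K y ω θ := by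
  unfold aliveInd; split_ifs <;> norm_num

theorem aliveInd_le_one (K : ℝ) (ω : List (Fin m)) (θ : Θ) : aliveInd b K y ω θ ≤ 1 := by
  unfold aliveInd; split_ifs <;> norm_num

theorem aliveInd_concat_le (K : ℝ) (ω : List (Fin m)) (i : Fin m) (θ : Θ) :
    aliveInd b K y (ω ++ [i]) θ ≤ aliveInd b K y ω θ := by
  unfold aliveInd
  split_ifs with h1 h2 <;> norm_num
  exact h2 (alive_concat.1 h1).1

theorem measurable_past_aliveInd (K : ℝ) (ω : List (Fin m)) :
    Measurable[past y ω.length] (aliveInd b K y ω) := by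
  classical
  exact Measurable.ite (measurableSet_past_alive K ω) measurable_const measurable_const

theorem measurable_past_aliveInd_mul_amp (K : ℝ) (ω : List (Fin m)) :
    Measurable[past y ω.length] fun θ => aliveInd b K y ω θ * |amp (fun τ => y τ θ) ω| :=
  (measurable_past_aliveInd K ω).mul (measurable_past_abs_amp ω)

/-- The logarithm of the slope of `R_ω`. -/
noncomputable def logSlope (b : Fin (m + 1) → ℝ) (y : List (Fin m) → Θ → Fin (m + 1) → ℝ)
    (ω : List (Fin m)) (θ : Θ) : ℝ := Real.log (|amp (fun τ => y τ θ) ω| / len b ω)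

/-- A potential whose expected total over the alive words decreases. -/
noncomputable def potential (C l h : ℝ) : ℝ := C * l - h + l * (Real.log C - Real.log (h / l))

theorem log_div_le {C l h : ℝ} (hC : 1 ≤ C) (hl : 0 < l) (h0 : 0 ≤ h) (hle : h ≤ C * l) :
    Real.log (h / l) ≤ Real.log C := by
  obtain rfl | h1 := h0.eq_or_lt
  · rw [zero_div, Real.log_zero]; exact Real.log_nonneg hC
  · exact Real.log_le_log (by positivity) ((div_le_iff₀ hl).2 hle)

theorem potential_nonneg {C l h : ℝ} (hC : 1 ≤ C) (hl : 0 < l) (h0 : 0 ≤ h) (hle : h ≤ C * l) :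
    0 ≤ potential C l h :=
  add_nonneg (by linarith) (mul_nonneg hl.le (sub_nonneg.2 (log_div_le hC hl h0 hle)))

/-- Either the slope is below `C * exp (-M)`, and the logarithmic term of the potential is at least
`l * M`, or the length is at most `exp M / C` times the height. -/
theorem le_potential {C l h M : ℝ} (hC : 1 ≤ C) (hl : 0 < l) (h0 : 0 < h) (hle : h ≤ C * l)
    (hM : 0 < M) : l ≤ potential C l h / M + Real.exp M / C * h := by
  have hC0 : 0 < C := by linarith
  have h2 := potential_nonneg hC hl h0.le hle
  obtain h1 | h1 := le_total (Real.log (h / l)) (Real.log C - M)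
  · have h3 : l * M ≤ potential C l h := by
      have : l * M ≤ l * (Real.log C - Real.log (h / l)) :=
        mul_le_mul_of_nonneg_left (by linarith) hl.le
      unfold potential
      linarith
    have h4 : l ≤ potential C l h / M := (le_div_iff₀ hM).2 h3
    have h5 : 0 ≤ Real.exp M / C * h := by positivity
    linarith
  · have h3 := Real.exp_le_exp.2 h1
    rw [Real.exp_log (by positivity), Real.exp_sub, Real.exp_log hC0,
      div_le_div_iff₀ (Real.exp_pos M) hl] at h3
    have h4 : l ≤ Real.exp M / C * h := by
      rw [div_mul_eq_mul_div, le_div_iff₀ hC0]; linarith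
    have h5 : 0 ≤ potential C l h / M := by positivity
    linarith

variable [MeasurableSpace Θ] {P : Measure Θ}

theorem indepFun_past (hy : IsRandomTree P y) {ω : List (Fin m)} {Z : Θ → ℝ}
    (hZ : Measurable[past y ω.length] Z) {g : (Fin (m + 1) → ℝ) → ℝ} (hg : Measurable g) :
    IndepFun Z (fun θ => g (y ω θ)) P := by
  rw [IndepFun_iff_Indep]
  refine indep_of_indep_of_le_left (indep_of_indep_of_le_right (indep_past hy ω) ?_)
    hZ.comap_le
  exact (hg.comp (comap_measurable (y ω))).comap_le

theorem integral_past_mul (hy : IsRandomTree P y) {ω : List (Fin m)} {Z : Θ → ℝ}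
    (hZ : Measurable[past y ω.length] Z) {g : (Fin (m + 1) → ℝ) → ℝ} (hg : Measurable g) :
    ∫ θ, Z θ * g (y ω θ) ∂P = (∫ θ, Z θ ∂P) * ∫ θ, g (y [] θ) ∂P := by
  rw [(indepFun_past hy hZ hg).integral_fun_mul_eq_mul_integral
    (hZ.mono (past_le hy _) le_rfl).aestronglyMeasurable
    (hg.comp (hy.measurable ω)).aestronglyMeasurable]
  congr 1
  exact ((hy.ident ω).comp hg).integral_eq

theorem integrable_past_mul (hy : IsRandomTree P y) {ω : List (Fin m)} {Z : Θ → ℝ}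
    (hZ : Measurable[past y ω.length] Z) {g : (Fin (m + 1) → ℝ) → ℝ} (hg : Measurable g)
    (hZi : Integrable Z P) (hgi : Integrable (fun θ => g (y [] θ)) P) :
    Integrable (fun θ => Z θ * g (y ω θ)) P :=
  (indepFun_past hy hZ hg).integrable_mul hZi (((hy.ident ω).comp hg).integrable_iff.2 hgi)

theorem ae_gap_pos (hy : IsRandomTree P y) (hlog : LogIntegrable P (y [])) :
    ∀ᵐ θ ∂P, ∀ ω i, 0 < gap i (y ω θ) := by
  rw [ae_all_iff]
  intro ω
  rw [ae_all_iff]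
  intro i
  exact ((hy.ident ω).comp (measurable_gap i)).symm.ae_snd (p := fun t => 0 < t)
    measurableSet_Ioi (hlog i).1

theorem ae_amp_pos (hy : IsRandomTree P y) (hlog : LogIntegrable P (y [])) :
    ∀ᵐ θ ∂P, ∀ ω, 0 < |amp (fun τ => y τ θ) ω| := by
  filter_upwards [ae_gap_pos hy hlog] with θ hθ ω
  induction ω using List.reverseRecOn with
  | nil => simp [amp]
  | append_singleton ω i ih =>
    rw [amp_concat, abs_mul]
    exact mul_pos ih (hθ ω i)

theorem ae_logSlope_concat (hb : IsPartition b) (hy : IsRandomTree P y)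
    (hlog : LogIntegrable P (y [])) (ω : List (Fin m)) (i : Fin m) :
    ∀ᵐ θ ∂P, logSlope b y (ω ++ [i]) θ =
      logSlope b y ω θ + (Real.log (gap i (y ω θ)) - Real.log (b i.succ - b i.castSucc)) := by
  filter_upwards [ae_gap_pos hy hlog, ae_amp_pos hy hlog] with θ h1 h2
  have h3 := len_pos hb ω
  have h4 := hb.sub_pos i
  rw [logSlope, logSlope, amp_concat, len_concat, abs_mul, mul_div_mul_comm,
    Real.log_mul (div_pos (h2 ω) h3).ne' (div_pos (h1 ω i) h4).ne',
    Real.log_div (h1 ω i).ne' h4.ne']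

theorem integrable_logSlope [IsProbabilityMeasure P] (hb : IsPartition b)
    (hy : IsRandomTree P y) (hlog : LogIntegrable P (y [])) (ω : List (Fin m)) :
    Integrable (logSlope b y ω) P := by
  induction ω using List.reverseRecOn with
  | nil =>
    have : logSlope b y [] = fun _ => 0 := by funext θ; simp [logSlope, amp]
    rw [this]
    exact integrable_const _
  | append_singleton ω i ih =>
    have h : Integrable (fun θ => Real.log (gap i (y ω θ))) P :=
      (((hy.ident ω).comp (Real.measurable_log.comp (measurable_gap i))).integrable_iff).2
        (hlog i).2
    exact (ih.add (h.sub (integrable_const _))).congr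
      (by filter_upwards [ae_logSlope_concat hb hy hlog ω i] with θ hθ using hθ.symm)

theorem measurable_aliveInd (hy : IsRandomTree P y) (K : ℝ) (ω : List (Fin m)) :
    Measurable (aliveInd b K y ω) := (measurable_past_aliveInd K ω).mono (past_le hy _) le_rfl

theorem integrable_aliveInd_mul (hy : IsRandomTree P y) (K : ℝ) (ω : List (Fin m)) {f : Θ → ℝ}
    (hf : Integrable f P) : Integrable (fun θ => aliveInd b K y ω θ * f θ) P :=
  hf.bdd_mul (c := 1) (measurable_aliveInd hy K ω).aestronglyMeasurable
    (Filter.Eventually.of_forall fun θ => by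
      rw [Real.norm_of_nonneg (aliveInd_nonneg K ω θ)]; exact aliveInd_le_one K ω θ)

theorem integrable_abs_amp [IsProbabilityMeasure P] (hy : IsRandomTree P y) (ω : List (Fin m)) :
    Integrable (fun θ => |amp (fun τ => y τ θ) ω|) P :=
  Integrable.of_bound (C := 1) (measurable_amp hy ω).abs.aestronglyMeasurable
    (Filter.Eventually.of_forall fun θ => by
      rw [Real.norm_of_nonneg (abs_nonneg _)]
      exact abs_amp_le_one (fun τ => hy.heights τ θ) ω)

theorem integrable_gap [IsProbabilityMeasure P] (hy : IsRandomTree P y) (i : Fin m) :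
    Integrable (fun θ => gap i (y [] θ)) P :=
  Integrable.of_bound (C := 1)
    ((measurable_gap i).comp (hy.measurable [])).aestronglyMeasurable
    (Filter.Eventually.of_forall fun θ => by
      rw [Real.norm_of_nonneg (abs_nonneg _)]
      exact (hy.heights [] θ).abs_sub_le _ _)

theorem integrable_potential [IsProbabilityMeasure P] (hb : IsPartition b)
    (hy : IsRandomTree P y) (hlog : LogIntegrable P (y [])) (C : ℝ) (ω : List (Fin m)) :
    Integrable (fun θ => potential C (len b ω) |amp (fun τ => y τ θ) ω|) P :=
  ((integrable_const _).sub (integrable_abs_amp hy ω)).add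
    (((integrable_const _).sub (integrable_logSlope hb hy hlog ω)).const_mul _)

/-- The indicator is that of the parent, hence independent of `y ω`. On average the children's
lengths add up to the parent's, their heights to `ρ` times its height, and their length-weighted log
slope gains `φ` times its length. -/
theorem integral_alive_children [IsProbabilityMeasure P] (hb : IsPartition b)
    (hy : IsRandomTree P y) (hlog : LogIntegrable P (y [])) (K C : ℝ) (ω : List (Fin m)) :
    ∑ i, ∫ θ, aliveInd b K y ω θ *
        potential C (len b (ω ++ [i])) |amp (fun τ => y τ θ) (ω ++ [i])| ∂P =
      ∫ θ, aliveInd b K y ω θ * potential C (len b ω) |amp (fun τ => y τ θ) ω| ∂P -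
        (∑ i : Fin m, ∫ θ, gap i (y [] θ) ∂P - 1) *
          ∫ θ, aliveInd b K y ω θ * |amp (fun τ => y τ θ) ω| ∂P -
        (∑ i : Fin m, (b i.succ - b i.castSucc) *
          (∫ θ, Real.log (gap i (y [] θ)) ∂P - Real.log (b i.succ - b i.castSucc))) *
          (len b ω * ∫ θ, aliveInd b K y ω θ ∂P) := by
  set χ := aliveInd b K y ω with hχ
  set H : Θ → ℝ := fun θ => |amp (fun τ => y τ θ) ω| with hH
  set L := logSlope b y ω with hL
  set l := len b ω with hl
  have hχm : Measurable[past y ω.length] χ := measurable_past_aliveInd K ω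
  have hHm : Measurable[past y ω.length] fun θ => χ θ * H θ :=
    measurable_past_aliveInd_mul_amp K ω
  have hχi : Integrable χ P := by
    simpa using integrable_aliveInd_mul (b := b) hy K ω (integrable_const (1 : ℝ))
  have hHi : Integrable (fun θ => χ θ * H θ) P :=
    integrable_aliveInd_mul hy K ω (integrable_abs_amp hy ω)
  -- The part of the weighted potential without `-h`: it is carried over in proportion to the cell
  -- lengths and so is preserved by summation.
  let A : Θ → ℝ := fun θ => χ θ * (C * l + l * (Real.log C - L θ))
  have hAi : Integrable A P := integrable_aliveInd_mul hy K ω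
    ((integrable_const _).add (((integrable_const _).sub
      (integrable_logSlope hb hy hlog ω)).const_mul _))
  have hpar : ∫ θ, χ θ * potential C l (H θ) ∂P = ∫ θ, A θ ∂P - ∫ θ, χ θ * H θ ∂P := by
    rw [← integral_sub hAi hHi]
    refine integral_congr_ae (Filter.Eventually.of_forall fun θ => ?_)
    simp only [potential, A, hL, logSlope, hH, hl]
    ring
  have hchild : ∀ i : Fin m, ∫ θ, χ θ *
        potential C (len b (ω ++ [i])) |amp (fun τ => y τ θ) (ω ++ [i])| ∂P =
      (b i.succ - b i.castSucc) * ∫ θ, A θ ∂P -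
        (∫ θ, gap i (y [] θ) ∂P) * ∫ θ, χ θ * H θ ∂P -
        ((b i.succ - b i.castSucc) *
          (∫ θ, Real.log (gap i (y [] θ)) ∂P - Real.log (b i.succ - b i.castSucc))) *
          (l * ∫ θ, χ θ ∂P) := by
    intro i
    set d := b i.succ - b i.castSucc with hd
    have hgm : Measurable fun v : Fin (m + 1) → ℝ => Real.log (gap i v) - Real.log d :=
      (Real.measurable_log.comp (measurable_gap i)).sub_const _
    have hgi : Integrable (fun θ => Real.log (gap i (y [] θ)) - Real.log d) P :=
      (hlog i).2.sub (integrable_const _)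
    have i1 := integrable_past_mul hy hHm (measurable_gap i) hHi (integrable_gap hy i)
    have i2 := integrable_past_mul hy hχm hgm hχi hgi
    have e1 := integral_past_mul hy hHm (measurable_gap i)
    have e2 := integral_past_mul hy hχm hgm
    rw [integral_sub (hlog i).2 (integrable_const _)] at e2
    simp only [integral_const, probReal_univ, one_smul] at e2
    have i0 : Integrable (fun θ => d * A θ - χ θ * H θ * gap i (y ω θ)) P := (hAi.const_mul _).sub i1
    calc ∫ θ, χ θ * potential C (len b (ω ++ [i])) |amp (fun τ => y τ θ) (ω ++ [i])| ∂P
        = ∫ θ, (d * A θ - χ θ * H θ * gap i (y ω θ) -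
            (d * l) * (χ θ * (Real.log (gap i (y ω θ)) - Real.log d))) ∂P := by
          refine integral_congr_ae ?_
          filter_upwards [ae_logSlope_concat hb hy hlog ω i] with θ hθ
          rw [logSlope] at hθ
          rw [potential, hθ, amp_concat, len_concat, abs_mul]
          simp only [A, hL, hH, hl, hd]
          ring
      _ = _ := by
          rw [integral_sub i0 (i2.const_mul _),
            integral_sub (hAi.const_mul _) i1, integral_const_mul, integral_const_mul, e1, e2]
          ring
  rw [Finset.sum_congr rfl fun i _ => hchild i, hpar, Finset.sum_sub_distrib,
    Finset.sum_sub_distrib, ← Finset.sum_mul, ← Finset.sum_mul, ← Finset.sum_mul,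
    sum_sub_eq_one hb.isHeights]
  ring

/-- Summing `lᵢ (t - 1 - log t) ≥ 0` at `t = aᵢ/lᵢ` gives `∑ E aᵢ - 1 ≥ φ ≥ 0`. Equality with `1`
forces `aᵢ = lᵢ` almost surely for every cell, contrary to `hdiag`. -/
theorem one_lt_sum_integral_gap [IsProbabilityMeasure P] (hm : 2 ≤ m) (hb : IsPartition b)
    (hy : IsRandomTree P y) (hlog : LogIntegrable P (y []))
    (hphi : 0 ≤ ∑ i : Fin m, (b i.succ - b i.castSucc) *
      (∫ θ, Real.log (gap i (y [] θ)) ∂P - Real.log (b i.succ - b i.castSucc)))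
    (hdiag : ∀ i : Fin m, 1 ≤ (i : ℕ) →
      P {θ | y [] θ i.succ - y [] θ i.castSucc = b i.succ - b i.castSucc} < 1) :
    1 < ∑ i : Fin m, ∫ θ, gap i (y [] θ) ∂P := by
  by_contra! hle
  set l : Fin m → ℝ := fun i => b i.succ - b i.castSucc with hl
  have hl0 : ∀ i, 0 < l i := hb.sub_pos
  have hlsum : ∑ i, l i = 1 := sum_sub_eq_one hb.isHeights
  let f : Fin m → Θ → ℝ := fun i θ =>
    gap i (y [] θ) - l i - l i * (Real.log (gap i (y [] θ)) - Real.log (l i))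
  have hscale : ∀ i θ, 0 < gap i (y [] θ) →
      f i θ = l i * (gap i (y [] θ) / l i - 1 - Real.log (gap i (y [] θ) / l i)) := by
    intro i θ h
    rw [Real.log_div h.ne' (hl0 i).ne']
    have := (hl0 i).ne'
    simp only [f]
    field_simp
  have hpos : ∀ᵐ θ ∂P, ∀ i, 0 < gap i (y [] θ) := ae_all_iff.2 fun i => (hlog i).1
  have hf0 : ∀ᵐ θ ∂P, ∀ i, 0 ≤ f i θ := by
    filter_upwards [hpos] with θ hθ i
    rw [hscale i θ (hθ i)]
    refine mul_nonneg (hl0 i).le ?_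
    linarith [Real.log_le_sub_one_of_pos (div_pos (hθ i) (hl0 i))]
  have hfi : ∀ i, Integrable (f i) P := fun i =>
    ((integrable_gap hy i).sub (integrable_const _)).sub
      (((hlog i).2.sub (integrable_const _)).const_mul _)
  have hint : ∀ i, ∫ θ, f i θ ∂P = ∫ θ, gap i (y [] θ) ∂P - l i -
      l i * (∫ θ, Real.log (gap i (y [] θ)) ∂P - Real.log (l i)) := by
    intro i
    have h1 : Integrable (fun θ => gap i (y [] θ) - l i) P :=
      (integrable_gap hy i).sub (integrable_const _)
    have h2 : Integrable (fun θ => Real.log (gap i (y [] θ)) - Real.log (l i)) P :=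
      (hlog i).2.sub (integrable_const _)
    simp only [f]
    rw [integral_sub h1 (h2.const_mul _), integral_const_mul,
      integral_sub (integrable_gap hy i) (integrable_const _),
      integral_sub (hlog i).2 (integrable_const _)]
    simp
  have hsum : ∑ i, ∫ θ, f i θ ∂P ≤ 0 := by
    simp only [hint, Finset.sum_sub_distrib, hlsum]
    linarith
  have hnn : ∀ i, 0 ≤ ∫ θ, f i θ ∂P := fun i =>
    integral_nonneg_of_ae (by filter_upwards [hf0] with θ hθ using hθ i)
  have hzero : ∀ i, ∫ θ, f i θ ∂P = 0 := fun i =>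
    (Finset.sum_eq_zero_iff_of_nonneg fun i _ => hnn i).1
      (le_antisymm hsum (Finset.sum_nonneg fun i _ => hnn i)) i (Finset.mem_univ i)
  have hfz : ∀ᵐ θ ∂P, ∀ i, f i θ = 0 := by
    rw [ae_all_iff]
    intro i
    exact (integral_eq_zero_iff_of_nonneg_ae (by filter_upwards [hf0] with θ hθ using hθ i)
      (hfi i)).1 (hzero i)
  have hgap : ∀ᵐ θ ∂P, ∀ i, gap i (y [] θ) = l i := by
    filter_upwards [hpos, hfz] with θ h1 h2 i
    have h3 := h2 i
    rw [hscale i θ (h1 i)] at h3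
    have h4 := (mul_eq_zero.1 h3).resolve_left (hl0 i).ne'
    by_contra hne
    have h5 : gap i (y [] θ) / l i ≠ 1 := fun h => hne (by rwa [div_eq_one_iff_eq (hl0 i).ne'] at h)
    linarith [Real.log_lt_sub_one_of_pos (div_pos (h1 i) (hl0 i)) h5]
  -- The signed increments are at most `l i` and have the same sum `1`, so no increment can be
  -- negative.
  have hall : ∀ᵐ θ ∂P, ∀ i : Fin m, y [] θ i.succ - y [] θ i.castSucc = l i := by
    filter_upwards [hgap] with θ hθ i
    have h1 : ∑ i : Fin m, (l i - (y [] θ i.succ - y [] θ i.castSucc)) = 0 := by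
      rw [Finset.sum_sub_distrib, hlsum, sum_sub_eq_one (hy.heights [] θ), sub_self]
    have h2 := (Finset.sum_eq_zero_iff_of_nonneg fun i _ =>
      sub_nonneg.2 ((le_abs_self _).trans (hθ i).le)).1 h1 i (Finset.mem_univ i)
    linarith
  have hlt := hdiag ⟨1, hm⟩ le_rfl
  have h1 : P {θ | y [] θ (Fin.succ ⟨1, hm⟩) - y [] θ (Fin.castSucc ⟨1, hm⟩) =
      b (Fin.succ ⟨1, hm⟩) - b (Fin.castSucc ⟨1, hm⟩)} = 1 := by
    rw [measure_congr (Filter.eventuallyEq_univ.2 ?_), measure_univ]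
    filter_upwards [hall] with θ hθ using hθ ⟨1, hm⟩
  exact hlt.ne h1

end

/-! ### The case `φ ≥ 0`: the length of the alive words vanishes. -/

section

variable {m : ℕ} {b : Fin (m + 1) → ℝ} {u : List (Fin m) → Fin (m + 1) → ℝ}
  {Θ : Type*} {y : List (Fin m) → Θ → Fin (m + 1) → ℝ}

/-- A child of an alive word may exceed slope `K`, but only by the factor `1 / c`. This keeps the
potential nonnegative on children that are killed. -/
theorem Alive.abs_amp_concat_le (hb : IsPartition b) (hu : ∀ τ, IsHeights (u τ)) {c K : ℝ}
    (hc0 : 0 < c) (hc : ∀ i : Fin m, c ≤ b i.succ - b i.castSucc) {ω : List (Fin m)}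
    (h : Alive b K u ω) (i : Fin m) :
    |amp u (ω ++ [i])| ≤ max K 1 / c * len b (ω ++ [i]) := by
  have hl := len_pos hb ω
  rw [amp_concat, len_concat, abs_mul]
  calc |amp u ω| * |u ω i.succ - u ω i.castSucc| ≤ (K * len b ω) * 1 :=
        mul_le_mul (h ω List.prefix_rfl) ((hu ω).abs_sub_le _ _) (abs_nonneg _)
          ((abs_nonneg _).trans (h ω List.prefix_rfl))
    _ ≤ max K 1 * len b ω := by rw [mul_one]; gcongr; exact le_max_left _ _
    _ = max K 1 / c * (len b ω * c) := by field_simp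
    _ ≤ max K 1 / c * (len b ω * (b i.succ - b i.castSucc)) := by gcongr; exact hc i

theorem Alive.abs_amp_le (hb : IsPartition b) {c K : ℝ} (hc0 : 0 < c) (hc1 : c ≤ 1)
    {ω : List (Fin m)} (h : Alive b K u ω) : |amp u ω| ≤ max K 1 / c * len b ω := by
  have hl := len_pos hb ω
  refine (h ω List.prefix_rfl).trans ?_
  gcongr
  exact (le_max_left _ _).trans (le_div_self (by positivity) hc0 hc1)

theorem aliveLength_eq (K : ℝ) (n : ℕ) (θ : Θ) :
    aliveLength b K (fun τ => y τ θ) n = ∑ ω ∈ words m n, aliveInd b K y ω θ * len b ω := by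
  simp only [aliveLength, aliveInd, ite_mul, one_mul, zero_mul]

theorem aliveLength_nonneg (hb : IsPartition b) (K : ℝ) (n : ℕ) : 0 ≤ aliveLength b K u n :=
  Finset.sum_nonneg fun ω _ => by
    split_ifs
    · exact (len_pos hb ω).le
    · exact le_rfl

variable [MeasurableSpace Θ] {P : Measure Θ}

theorem integrable_aliveLength [IsProbabilityMeasure P] (hy : IsRandomTree P y) (K : ℝ) (n : ℕ) :
    Integrable (fun θ => aliveLength b K (fun τ => y τ θ) n) P := by
  simp only [aliveLength_eq]
  exact integrable_finsetSum _ fun ω _ => integrable_aliveInd_mul hy K ω (integrable_const _)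

theorem exists_integral_aliveLength_le [IsProbabilityMeasure P] (hm : 2 ≤ m)
    (hb : IsPartition b) (hy : IsRandomTree P y) (hlog : LogIntegrable P (y []))
    (hphi : 0 ≤ ∑ i : Fin m, (b i.succ - b i.castSucc) *
      (∫ θ, Real.log (gap i (y [] θ)) ∂P - Real.log (b i.succ - b i.castSucc)))
    (hdiag : ∀ i : Fin m, 1 ≤ (i : ℕ) →
      P {θ | y [] θ i.succ - y [] θ i.castSucc = b i.succ - b i.castSucc} < 1)
    (K : ℝ) {ε : ℝ} (hε : 0 < ε) :
    ∃ n, ∫ θ, aliveLength b K (fun τ => y τ θ) n ∂P ≤ ε := by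
  have hρ := one_lt_sum_integral_gap hm hb hy hlog hphi hdiag
  set ρ := ∑ i : Fin m, ∫ θ, gap i (y [] θ) ∂P
  obtain ⟨c, hc0, hc1, hc⟩ := hb.exists_le_sub
  set C := max K 1 / c with hC
  have hC1 : 1 ≤ C := (le_max_right K 1).trans (le_div_self (by positivity) hc0 hc1)
  have hC0 : 0 < C := one_pos.trans_le hC1
  let H : List (Fin m) → Θ → ℝ := fun ω θ => |amp (fun τ => y τ θ) ω|
  let V : List (Fin m) → Θ → ℝ := fun ω θ => potential C (len b ω) (H ω θ)
  let e : ℕ → ℝ := fun n => ∑ ω ∈ words m n, ∫ θ, aliveInd b K y ω θ * H ω θ ∂P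
  let v : ℕ → ℝ := fun n => ∑ ω ∈ words m n, ∫ θ, aliveInd b K y ω θ * V ω θ ∂P
  have hVi : ∀ ω, Integrable (V ω) P := integrable_potential hb hy hlog C
  have hHi : ∀ ω, Integrable (H ω) P := integrable_abs_amp hy
  have hχV : ∀ ω θ, 0 ≤ aliveInd b K y ω θ * V ω θ := by
    intro ω θ
    unfold aliveInd
    split_ifs with h
    · rw [one_mul]
      exact potential_nonneg hC1 (len_pos hb ω) (abs_nonneg _) (h.abs_amp_le hb hc0 hc1)
    · rw [zero_mul]
  -- Killing children discards nonnegative potential, and `φ ≥ 0` allows the drift term to be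
  -- dropped.
  have hstep : ∀ n, v (n + 1) ≤ v n - (ρ - 1) * e n := by
    intro n
    simp only [v, e]
    rw [sum_words_succ, Finset.mul_sum, ← Finset.sum_sub_distrib]
    refine Finset.sum_le_sum fun ω _ => ?_
    have h1 : ∑ i, ∫ θ, aliveInd b K y (ω ++ [i]) θ * V (ω ++ [i]) θ ∂P ≤
        ∑ i, ∫ θ, aliveInd b K y ω θ * V (ω ++ [i]) θ ∂P := by
      refine Finset.sum_le_sum fun i _ => integral_mono
        (integrable_aliveInd_mul hy K _ (hVi _)) (integrable_aliveInd_mul hy K _ (hVi _)) ?_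
      intro θ
      by_cases h : Alive b K (fun τ => y τ θ) ω
      · exact mul_le_mul_of_nonneg_right (aliveInd_concat_le K ω i θ)
          (potential_nonneg hC1 (len_pos hb _) (abs_nonneg _)
            (h.abs_amp_concat_le hb (fun τ => hy.heights τ θ) hc0 hc i))
      · have h2 : ¬ Alive b K (fun τ => y τ θ) (ω ++ [i]) := fun h2 => h (alive_concat.1 h2).1
        simp [aliveInd, h, h2]
    refine h1.trans ?_
    rw [integral_alive_children hb hy hlog K C ω]
    refine sub_le_self _ (mul_nonneg hphi (mul_nonneg (len_pos hb ω).le ?_))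
    exact integral_nonneg fun θ => aliveInd_nonneg K ω θ
  have he0 : ∀ n, 0 ≤ e n := fun n => Finset.sum_nonneg fun ω _ =>
    integral_nonneg fun θ => mul_nonneg (aliveInd_nonneg K ω θ) (abs_nonneg _)
  have hv0 : ∀ n, 0 ≤ v n := fun n => Finset.sum_nonneg fun ω _ => integral_nonneg (hχV ω)
  have hvle : ∀ n, v n ≤ v 0 - (ρ - 1) * ∑ k ∈ Finset.range n, e k := by
    intro n
    induction n with
    | zero => simp
    | succ n ih => rw [Finset.sum_range_succ, mul_add]; linarith [hstep n]
  have hv : ∀ n, v n ≤ v 0 := fun n => (hvle n).trans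
    (sub_le_self _ (mul_nonneg (by linarith) (Finset.sum_nonneg fun k _ => he0 k)))
  -- Since `v ≥ 0`, the telescoped inequality bounds `(ρ - 1) * ∑ e k` by `v 0`.
  have hesmall : ∀ η > 0, ∃ n, e n ≤ η := by
    intro η hη
    by_contra! hcon
    obtain ⟨N, hN⟩ := exists_nat_gt (v 0 / ((ρ - 1) * η))
    have hρη : 0 < (ρ - 1) * η := mul_pos (by linarith) hη
    rw [div_lt_iff₀ hρη] at hN
    have h1 : N * η ≤ ∑ k ∈ Finset.range N, e k := by
      have := Finset.card_nsmul_le_sum (Finset.range N) e η fun k _ => (hcon k).le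
      simpa using this
    have h2 := mul_le_mul_of_nonneg_left h1 (by linarith : (0 : ℝ) ≤ ρ - 1)
    have h3 := hvle N
    have h4 := hv0 N
    linarith
  -- Chosen so that the potential contributes at most `ε / 2`; the level `n` is then chosen to make
  -- the height term at most `ε / 2`.
  set M := 2 * (v 0 + 1) / ε with hM
  have hM0 : 0 < M := by have := hv0 0; positivity
  obtain ⟨n, hn⟩ := hesmall (ε / 2 / (Real.exp M / C)) (by positivity)
  refine ⟨n, ?_⟩
  have hle : ∀ᵐ θ ∂P, aliveLength b K (fun τ => y τ θ) n ≤ ∑ ω ∈ words m n,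
      (aliveInd b K y ω θ * V ω θ / M + Real.exp M / C * (aliveInd b K y ω θ * H ω θ)) := by
    filter_upwards [ae_amp_pos hy hlog] with θ hθ
    rw [aliveLength_eq]
    refine Finset.sum_le_sum fun ω _ => ?_
    unfold aliveInd
    split_ifs with h
    · simp only [one_mul]
      exact le_potential hC1 (len_pos hb ω) (hθ ω) (h.abs_amp_le hb hc0 hc1) hM0
    · simp
  have hi1 : ∀ ω, Integrable (fun θ => aliveInd b K y ω θ * V ω θ / M) P := fun ω =>
    (integrable_aliveInd_mul hy K ω (hVi ω)).div_const _
  have hi2 : ∀ ω, Integrable (fun θ => Real.exp M / C * (aliveInd b K y ω θ * H ω θ)) P :=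
    fun ω => (integrable_aliveInd_mul hy K ω (hHi ω)).const_mul _
  have hi : ∀ ω, Integrable (fun θ => aliveInd b K y ω θ * V ω θ / M +
      Real.exp M / C * (aliveInd b K y ω θ * H ω θ)) P := fun ω => (hi1 ω).add (hi2 ω)
  refine (integral_mono_ae (integrable_aliveLength hy K n)
    (integrable_finsetSum _ fun ω _ => hi ω) hle).trans ?_
  rw [integral_finsetSum _ fun ω _ => hi ω]
  have h1 : ∀ ω, ∫ θ, (aliveInd b K y ω θ * V ω θ / M +
      Real.exp M / C * (aliveInd b K y ω θ * H ω θ)) ∂P =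
      (∫ θ, aliveInd b K y ω θ * V ω θ ∂P) / M +
        Real.exp M / C * ∫ θ, aliveInd b K y ω θ * H ω θ ∂P := by
    intro ω
    rw [integral_add (hi1 ω) (hi2 ω), integral_div, integral_const_mul]
  rw [Finset.sum_congr rfl fun ω _ => h1 ω, Finset.sum_add_distrib, ← Finset.sum_div,
    ← Finset.mul_sum]
  have h2 : v n / M ≤ ε / 2 := by
    rw [div_le_iff₀ hM0, hM]
    have : ε / 2 * (2 * (v 0 + 1) / ε) = v 0 + 1 := by field_simp
    linarith [hv n]
  have h3 : Real.exp M / C * e n ≤ ε / 2 := by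
    have hpos : 0 < Real.exp M / C := by positivity
    rw [le_div_iff₀ hpos] at hn
    linarith
  calc v n / M + Real.exp M / C * e n ≤ ε / 2 + ε / 2 := add_le_add h2 h3
    _ = ε := add_halves ε

theorem ae_exists_aliveLength_le [IsProbabilityMeasure P] (hb : IsPartition b)
    (hy : IsRandomTree P y) (K : ℝ)
    (h : ∀ ε > 0, ∃ n, ∫ θ, aliveLength b K (fun τ => y τ θ) n ∂P ≤ ε) :
    ∀ᵐ θ ∂P, ∀ ε > 0, ∃ n, aliveLength b K (fun τ => y τ θ) n ≤ ε := by
  have key : ∀ k : ℕ, ∀ᵐ θ ∂P, ∃ n, aliveLength b K (fun τ => y τ θ) n ≤ 1 / ((k : ℝ) + 1) := by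
    intro k
    have hk : (0 : ℝ) < 1 / ((k : ℝ) + 1) := by positivity
    rw [ae_iff, ← measureReal_eq_zero_iff]
    refine le_antisymm (le_of_forall_pos_le_add fun η hη => ?_) measureReal_nonneg
    -- By Markov's inequality, this mean bound makes the probability of exceeding `1 / (k + 1)` at
    -- most `η`.
    obtain ⟨n, hn⟩ := h (1 / ((k : ℝ) + 1) * η) (mul_pos hk hη)
    have h1 := mul_meas_ge_le_integral_of_nonneg
      (Filter.Eventually.of_forall fun θ => aliveLength_nonneg (u := fun τ => y τ θ) hb K n)
      (integrable_aliveLength hy K n) (1 / ((k : ℝ) + 1))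
    have h2 := le_of_mul_le_mul_left (h1.trans hn) hk
    rw [zero_add]
    refine le_trans (measureReal_mono fun θ hθ => ?_) h2
    simp only [mem_ofPred_eq, not_exists, not_le] at hθ ⊢
    exact (hθ n).le
  filter_upwards [ae_all_iff.2 key] with θ hθ ε hε
  obtain ⟨k, hk⟩ := exists_nat_one_div_lt hε
  obtain ⟨n, hn⟩ := hθ k
  exact ⟨n, hn.trans hk.le⟩

theorem ae_not_differentiableWithinAt [IsProbabilityMeasure P] (hm : 2 ≤ m) (hb : IsPartition b)
    (hy : IsRandomTree P y) (hs : ∀ᵐ θ ∂P, Shrinks fun τ => y τ θ)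
    (hdiag : ∀ i : Fin m, 1 ≤ (i : ℕ) →
      P {θ | y [] θ i.succ - y [] θ i.castSucc = b i.succ - b i.castSucc} < 1)
    (hphi : 0 ≤ phi P b (y [])) :
    ∀ᵐ θ ∂P, ∀ᵐ x ∂(volume.restrict (Icc (0 : ℝ) 1)),
      ¬ DifferentiableWithinAt ℝ (graphFun b (fun ω => y ω θ)) (Icc (0 : ℝ) 1) x := by
  have hlog := logIntegrable_of_phi_nonneg hb hy hphi
  rw [phi_eq_of_logIntegrable hy hlog, ← EReal.coe_zero, EReal.coe_le_coe_iff] at hphi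
  have h : ∀ᵐ θ ∂P, ∀ K : ℕ, ∀ ε > 0, ∃ n, aliveLength b K (fun τ => y τ θ) n ≤ ε :=
    ae_all_iff.2 fun K => ae_exists_aliveLength_le hb hy K fun ε hε =>
      exists_integral_aliveLength_le hm hb hy hlog hphi hdiag K hε
  filter_upwards [h, hs] with θ hθ hsθ
  filter_upwards [ae_steep hb (by omega) hθ] with x hx
  exact not_differentiableWithinAt_of_steep hb (fun τ => hy.heights τ θ) (by omega) hsθ hx

end

end RandomSelfAffine

theorem theorem2p2 {m : ℕ} (hm : 2 ≤ m)
    (b : Fin (m + 1) → ℝ) (hb : StrictMono b) (hb0 : b 0 = 0) (hb1 : b (Fin.last m) = 1)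
    {Θ : Type*} [MeasurableSpace Θ] (P : Measure Θ) [IsProbabilityMeasure P]
    -- `y ω θ i` is the random height `y_{ωi}`, for a finite word `ω` and `0 ≤ i ≤ m`
    (y : List (Fin m) → Θ → Fin (m + 1) → ℝ)
    (hmeas : ∀ ω, Measurable (y ω))
    (hindep : iIndepFun y P)
    (hident : ∀ ω, IdentDistrib (y ω) (y []) P P)
    (hy0 : ∀ ω θ, y ω θ 0 = 0)
    (hy1 : ∀ ω θ, y ω θ (Fin.last m) = 1)
    (hyI : ∀ ω θ i, y ω θ i ∈ Icc (0 : ℝ) 1)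
    (hnondeg : ∀ i : Fin (m + 1), i ≠ 0 → i ≠ Fin.last m →
      P {θ | y [] θ i = 0 ∨ y [] θ i = 1} = 0)
    (hdiag : ∀ i : Fin m, 1 ≤ (i : ℕ) →
      P {θ | y [] θ i.succ - y [] θ i.castSucc = b i.succ - b i.castSucc} < 1) :
    -- almost surely `Γ` is the graph of a continuous function `F : [0,1] → [0,1]`
    (∀ᵐ θ ∂P,
      ContinuousOn (RandomSelfAffine.graphFun b (fun ω => y ω θ)) (Icc (0 : ℝ) 1) ∧
      MapsTo (RandomSelfAffine.graphFun b (fun ω => y ω θ)) (Icc (0 : ℝ) 1) (Icc (0 : ℝ) 1) ∧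
      RandomSelfAffine.limitSet b (fun ω => y ω θ) =
        (Icc (0 : ℝ) 1).graphOn (RandomSelfAffine.graphFun b (fun ω => y ω θ))) ∧
    (RandomSelfAffine.phi P b (y []) < 0 →
      ∀ᵐ θ ∂P, ∀ᵐ x ∂(volume.restrict (Icc (0 : ℝ) 1)),
        HasDerivWithinAt (RandomSelfAffine.graphFun b (fun ω => y ω θ)) 0 (Icc (0 : ℝ) 1) x) ∧
    (0 ≤ RandomSelfAffine.phi P b (y []) →
      ∀ᵐ θ ∂P, ∀ᵐ x ∂(volume.restrict (Icc (0 : ℝ) 1)),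
        ¬ DifferentiableWithinAt ℝ (RandomSelfAffine.graphFun b (fun ω => y ω θ))
          (Icc (0 : ℝ) 1) x) := by
  have hP : RandomSelfAffine.IsPartition b := ⟨hb, hb0, hb1⟩
  have hy : RandomSelfAffine.IsRandomTree P y :=
    ⟨hmeas, hindep, hident, fun ω θ => ⟨hy0 ω θ, hy1 ω θ, hyI ω θ⟩⟩
  have hs := RandomSelfAffine.ae_shrinks hy (RandomSelfAffine.ae_gap_lt_one hm hy hnondeg)
  have hm0 : 0 < m := by omega
  refine ⟨?_, RandomSelfAffine.ae_hasDerivWithinAt_zero hP hm0 hy hs,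
    RandomSelfAffine.ae_not_differentiableWithinAt hm hP hy hs hdiag⟩
  filter_upwards [hs] with θ hθ
  exact ⟨RandomSelfAffine.continuousOn_graphFun hP (fun τ => hy.heights τ θ) hm0 hθ,
    RandomSelfAffine.mapsTo_graphFun hP (fun τ => hy.heights τ θ) hm0,
    RandomSelfAffine.limitSet_eq_graphOn hP (fun τ => hy.heights τ θ) hm0 hθ⟩
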